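/- Let $A,B$ be two qubits. All algebras are unital $*$-subalgebras of $\mathbb{M}_4(\mathbb{C})=\mathbb{B}(\mathcal{H}_A\otimes\mathcal{H}_B)$; $\langle\cdot\rangle$ is the generated algebra, $\mathcal{N}'$ the commutant, $\mathcal{S}\mathcal{T}=\langle \mathcal{S}\cup\mathcal{T}\rangle$, $\mathcal{E}_{\mathcal{N}}$ the trace-preserving conditional expectation onto $\mathcal{N}$, and $H(\mathcal{N})_\rho=-\mathrm{tr}(\mathcal{E}_{\mathcal{N}}(\rho)\log\mathcal{E}_{\mathcal{N}}(\rho))$. A pair $\mathcal{S},\mathcal{T}$ forms a commuting square if $\mathcal{E}_{\mathcal{S}}\mathcal{E}_{\mathcal{T}}=\mathcal{E}_{\mathcal{T}}\mathcal{E}_{\mathcal{S}}=\mathcal{E}_{\mathcal{S}\cap\mathcal{T}}$, and a co-commuting square if $\mathcal{S}',\mathcal{T}'$ form a commuting square. Put $I(\mathcal{S}:\mathcal{T})_\rho=H(\mathcal{S})_\rho+H(\mathcal{T})_\rho-H(\mathcal{S}\mathcal{T})_\rho-H(\mathcal{S}\cap\mathcal{T})_\rho$. For a commuting square with $\mathcal{S}\cap\mathcal{T}=\mathbb{C}1$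 let $I_{conv}(\mathcal{S}:\mathcal{T})_\rho=\frac12\inf\sum_x p_x I(\mathcal{S}:\mathcal{T})_{\rho_x}$ over finite ensembles of densities with $\rho=\sum_x p_x\rho_x$, and let $I_{sq}(\mathcal{S}:\mathcal{T})_\rho=\frac12\inf I(\tilde{\mathcal{S}}:\tilde{\mathcal{T}})_{\tilde\rho}$ over all finite-dimensional commuting squares $\tilde{\mathcal{S}},\tilde{\mathcal{T}}$ and densities $\tilde\rho\in\tilde{\mathcal{S}}\tilde{\mathcal{T}}$ for which $\tilde{\mathcal{S}}\cap(\tilde{\mathcal{S}}\cap\tilde{\mathcal{T}})'$ and $\tilde{\mathcal{T}}\cap(\tilde{\mathcal{S}}\cap\tilde{\mathcal{T}})'$ are the images of $\mathcal{S}$ and $\mathcal{T}$ under one embedding of $\mathcal{S}\mathcal{T}$, with unchanged expectations of the observables in $\mathcal{S}\mathcal{T}$. Let $I_*$ stand for either of $I_{sq},I_{conv}$. A *covariant averaging with algebra replacement* takes $(\mathcal{S},\mathcal{T},\rho)$ to $(\tilde{\mathcal{S}},\tilde{\mathcal{T}},\mathcal{E}_{\mathcal{R}}(\rho))$, where both pairs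 form commuting squares with $\mathcal{S}\mathcal{T}=\tilde{\mathcal{S}}\tilde{\mathcal{T}}$; $\mathcal{E}_{\mathcal{R}}$ is an average of conjugations by unitaries, each of which commutes (as a conjugation) with $\mathcal{E}_{\mathcal{S}},\mathcal{E}_{\mathcal{T}},\mathcal{E}_{\mathcal{S}\mathcal{T}},\mathcal{E}_{\mathcal{S}\cap\mathcal{T}}$; and $\tilde{\mathcal{S}}\cap\mathcal{R}=\mathcal{S}\cap\mathcal{R}$, $\tilde{\mathcal{T}}\cap\mathcal{R}=\mathcal{T}\cap\mathcal{R}$, $\tilde{\mathcal{S}}\cap\tilde{\mathcal{T}}\cap\mathcal{R}=\mathcal{S}\cap\mathcal{T}\cap\mathcal{R}$. **Corollary (EPR $\leftrightarrow$ 2UCR).** Let $\mathcal{S}=\langle Z_A,Z_B\rangle$, $\mathcal{T}=\langle X_A,X_B\rangle$, $\tilde{\mathcal{S}}=\langle X_A,Z_AZ_B\rangle$, $\tilde{\mathcal{T}}=\langle X_AX_B,Z_B\rangle$, let $\mathcal{A},\mathcal{B}$ be the full algebras of the two qubits, and let $\rho=|{\uparrow_Y}{\uparrow_Y}\rangle\langle{\uparrow_Y}{\uparrow_Y}|$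 with $|{\uparrow_Y}\rangle=\frac{1}{\sqrt2}(|0\rangle+i|1\rangle)$. The pairs $(\mathcal{S},\mathcal{T})$, $(\tilde{\mathcal{S}},\tilde{\mathcal{T}})$ and $(\mathcal{A},\mathcal{B})$ form commuting and co-commuting squares with intersection $\mathbb{C}1$, and: 1. There are a subalgebra $\mathcal{R}$ and an average of unitary conjugations equal to $\mathcal{E}_{\mathcal{R}}$ which define a covariant averaging with algebra replacement both from $(\mathcal{S},\mathcal{T})$ to $(\tilde{\mathcal{S}},\tilde{\mathcal{T}})$ and, reversing it, from $(\tilde{\mathcal{S}},\tilde{\mathcal{T}})$ to $(\mathcal{S},\mathcal{T})$, such that $\mathcal{E}_{\mathcal{R}}(\rho)=\rho$. So it converts the configuration $(\mathcal{S},\mathcal{T},\rho)$ to $(\tilde{\mathcal{S}},\tilde{\mathcal{T}},\rho)$ and back. Neither $I_{sq}$ nor $I_{conv}$ increases in either conversion: $I_*(\tilde{\mathcal{S}}:\tilde{\mathcal{T}})_{\mathcal{E}_{\mathcal{R}}(\rho)}\le I_*(\mathcal{S}:\mathcal{T})_\rho$ and $I_*(\mathcal{S}:\mathcal{T})_{\mathcal{E}_{\mathcal{R}}(\rho)}\le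 I_*(\tilde{\mathcal{S}}:\tilde{\mathcal{T}})_\rho$. Moreover the averaging $\sigma\mapsto\mathcal{E}_{\mathcal{R}}(\sigma)$ does not increase $I_*(\mathcal{S}:\mathcal{T})$ or $I_*(\tilde{\mathcal{S}}:\tilde{\mathcal{T}})$ on any density $\sigma$. 2. The configuration $(\tilde{\mathcal{S}},\tilde{\mathcal{T}},\rho)$ is equivalent to $(\mathcal{A},\mathcal{B},|\phi\rangle\langle\phi|)$ with the maximally entangled state $|\phi\rangle=\frac{1}{\sqrt2}(|0-\rangle+i|1+\rangle)$: there is a unitary $V$ with $V\tilde{\mathcal{S}}V^\dagger=\mathcal{A}$, $V\tilde{\mathcal{T}}V^\dagger=\mathcal{B}$ and $V|{\uparrow_Y}{\uparrow_Y}\rangle=|\phi\rangle$, and this renaming satisfies $I_*(\mathcal{A}:\mathcal{B})_{V\sigma V^\dagger}=I_*(\tilde{\mathcal{S}}:\tilde{\mathcal{T}})_\sigma$ for every density $\sigma$. -/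

import Mathlib

open scoped Matrix Kronecker ComplexOrder

noncomputable section

namespace SubalgebraResource

/-- A von Neumann subalgebra of the full matrix algebra `M_n(ℂ)`: a unital `*`-subalgebra. -/
abbrev Alg (n : Type) [Fintype n] [DecidableEq n] : Type := StarSubalgebra ℂ (Matrix n n ℂ)

section General

variable {n : Type} [Fintype n] [DecidableEq n]

/-- Existence of the trace-preserving conditional expectation, as the unique solution `e ∈ N` of
`tr (e b) = tr (a b)` for all `b ∈ N`. -/
theorem exists_unique_condExp (N : Alg n) (a : Matrix n n ℂ) :
    ∃! e : Matrix n n ℂ, e ∈ N ∧ ∀ b ∈ N, (e * b).trace = (a * b).trace := by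
  classical
  let W : Submodule ℂ (Matrix n n ℂ) := N.toSubalgebra.toSubmodule
  let tr2 : Matrix n n ℂ →ₗ[ℂ] Matrix n n ℂ →ₗ[ℂ] ℂ :=
    (LinearMap.mul ℂ (Matrix n n ℂ)).compr₂ (Matrix.traceLinearMap n ℂ ℂ)
  have key : ∀ x ∈ N, (∀ b ∈ N, (x * b).trace = 0) → x = 0 := by
    intro x hx h
    have h1 := h (star x) (star_mem hx)
    rw [Matrix.star_eq_conjTranspose] at h1
    exact Matrix.trace_mul_conjTranspose_self_eq_zero_iff.1 h1
  let f : W →ₗ[ℂ] Module.Dual ℂ W := tr2.domRestrict₁₂ W W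
  have hf : Function.Injective f := by
    rw [← LinearMap.ker_eq_bot, LinearMap.ker_eq_bot']
    intro x hx
    apply Subtype.ext
    refine key x.1 x.2 fun b hb => ?_
    exact LinearMap.congr_fun hx ⟨b, hb⟩
  have hs : Function.Surjective f :=
    (LinearMap.injective_iff_surjective_of_finrank_eq_finrank
      (Subspace.dual_finrank_eq (K := ℂ) (V := W)).symm).1 hf
  obtain ⟨e, he⟩ := hs ((tr2 a).comp W.subtype)
  refine ⟨e.1, ⟨e.2, fun b hb => LinearMap.congr_fun he ⟨b, hb⟩⟩, ?_⟩
  rintro y ⟨hy, hyb⟩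
  rw [← sub_eq_zero]
  refine key _ (sub_mem hy e.2) fun b hb => ?_
  have h2 : (e.1 * b).trace = (a * b).trace := LinearMap.congr_fun he ⟨b, hb⟩
  rw [sub_mul, Matrix.trace_sub, hyb b hb, h2, sub_self]

/-- The trace-preserving conditional expectation `E_N` onto the subalgebra `N`. -/
def condExp (N : Alg n) (a : Matrix n n ℂ) : Matrix n n ℂ :=
  (exists_unique_condExp N a).choose

theorem condExp_mem (N : Alg n) (a : Matrix n n ℂ) : condExp N a ∈ N :=
  (exists_unique_condExp N a).choose_spec.1.1

theorem trace_condExp_mul (N : Alg n) (a : Matrix n n ℂ) {b : Matrix n n ℂ} (hb : b ∈ N) :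
    (condExp N a * b).trace = (a * b).trace :=
  (exists_unique_condExp N a).choose_spec.1.2 b hb

/-- Density matrices. -/
def IsDensity (ρ : Matrix n n ℂ) : Prop := ρ.PosSemidef ∧ ρ.trace = 1

/-- The von Neumann entropy `H(ρ) = - tr (ρ log ρ)` (in bits), through the functional calculus. -/
def vonNeumannEntropy (ρ : Matrix n n ℂ) : ℝ :=
  (cfc Real.negMulLog ρ).trace.re / Real.log 2

/-- The subalgebra entropy `H(N)_ρ = H(E_N(ρ))`. -/
def algEntropy (N : Alg n) (ρ : Matrix n n ℂ) : ℝ := vonNeumannEntropy (condExp N ρ)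

/-- `S, T` form a commuting square: `E_S E_T = E_T E_S = E_{S ∩ T}`. -/
def IsCommutingSquare (S T : Alg n) : Prop :=
  ∀ a, condExp S (condExp T a) = condExp (S ⊓ T) a ∧ condExp T (condExp S a) = condExp (S ⊓ T) a

/-- The commutant of a subalgebra in `M_n(ℂ)`. -/
def commutant (N : Alg n) : Alg n := StarSubalgebra.centralizer ℂ (N : Set (Matrix n n ℂ))

/-- The generalized (conditional) mutual information
`I(S : T)_ρ = H(S)_ρ + H(T)_ρ - H(ST)_ρ - H(S ∩ T)_ρ`, where `ST = S ⊔ T` is the algebra generated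
by `S ∪ T`. -/
def mutualInfo (S T : Alg n) (ρ : Matrix n n ℂ) : ℝ :=
  algEntropy S ρ + algEntropy T ρ - algEntropy (S ⊔ T) ρ - algEntropy (S ⊓ T) ρ

/-- The observables of the party holding `S`, when the other one holds `T`: `S ∩ (S ∩ T)'`. -/
def party (S T : Alg n) : Alg n := S ⊓ commutant (S ⊓ T)

/-- The algebra generated by the observables of the two parties. -/
abbrev joint (S T : Alg n) : Alg n := party S T ⊔ party T S

/-- `(S', T', ρ')`, on a matrix algebra of any finite size `m`, is an extension of `(S, T, ρ)` along
the embedding `ι`: `S', T'` form a commuting square, `ρ'` is a density in `S'T'`, the algebras of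
the two parties are the same as for `S, T`, and the expectations of the observables that the
parties generate are unchanged. -/
structure IsExtension (S T : Alg n) (ρ : Matrix n n ℂ) {m : ℕ}
    (ι : joint S T →⋆ₐ[ℂ] Matrix (Fin m) (Fin m) ℂ)
    (S' T' : Alg (Fin m)) (ρ' : Matrix (Fin m) (Fin m) ℂ) : Prop where
  injective : Function.Injective ι
  square : IsCommutingSquare S' T'
  density : IsDensity ρ'
  mem : ρ' ∈ S' ⊔ T'
  party_left : ((party S T).comap (joint S T).subtype).map ι = party S' T'
  party_right : ((party T S).comap (joint S T).subtype).map ι = party T' S'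
  expectation : ∀ a : joint S T, (ρ' * ι a).trace = (ρ * (a : Matrix n n ℂ)).trace

/-- The squashed mutual information `I_sq(S : T)_ρ`, meant for commuting squares with
`S ∩ T = ℂ1`. The infimum is taken in the extended reals. -/
def Isq (S T : Alg n) (ρ : Matrix n n ℂ) : EReal :=
  sInf {x | ∃ (m : ℕ) (ι : joint S T →⋆ₐ[ℂ] Matrix (Fin m) (Fin m) ℂ) (S' T' : Alg (Fin m))
    (ρ' : Matrix (Fin m) (Fin m) ℂ), IsExtension S T ρ ι S' T' ρ' ∧
      x = ((1 / 2 * mutualInfo S' T' ρ' : ℝ) : EReal)}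

/-- The convex roof `I_conv(S : T)_ρ`, meant for commuting squares with `S ∩ T = ℂ1`. The infimum
is over the finite ensembles of densities that average to `ρ`, taken in the extended reals. -/
def Iconv (S T : Alg n) (ρ : Matrix n n ℂ) : EReal :=
  sInf {x | ∃ (k : ℕ) (p : Fin k → ℝ) (σ : Fin k → Matrix n n ℂ),
    (∀ i, 0 ≤ p i) ∧ ∑ i, p i = 1 ∧ (∀ i, IsDensity (σ i)) ∧ ∑ i, (p i : ℂ) • σ i = ρ ∧
      x = ((1 / 2 * ∑ i, p i * mutualInfo S T (σ i) : ℝ) : EReal)}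

/-- The standing assumptions under which `I`, `I_sq` and `I_conv` are considered: `S, T` form a
commuting and co-commuting square, with `S ∩ T = ℂ1`. -/
structure IsBipartition (S T : Alg n) : Prop where
  commuting : IsCommutingSquare S T
  cocommuting : IsCommutingSquare (commutant S) (commutant T)
  inf_eq_bot : S ⊓ T = ⊥

/-- Conjugation of a matrix by a unitary `U`, `a ↦ U a U†`, as a `*`-automorphism. -/
abbrev conj (U : unitary (Matrix n n ℂ)) : Matrix n n ℂ →⋆ₐ[ℂ] Matrix n n ℂ :=
  (Unitary.conjStarAlgAut ℂ (Matrix n n ℂ) U : Matrix n n ℂ →⋆ₐ[ℂ] Matrix n n ℂ)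

/-- Covariant averaging with algebra replacement, `(S, T, ρ) ↦ (S', T', E_R(ρ))`. The conditional
expectation `E_R` is an average of conjugations by unitaries `U i` with probabilities `w i`, each of
which commutes with the conditional expectations onto `S`, `T`, `ST` and `S ∩ T`; the new pair forms
a commuting square, generates the same algebra, and meets `R` in the same algebras as the old one. -/
structure IsCovariantReplacement (S T S' T' R : Alg n) {k : ℕ} (w : Fin k → ℝ)
    (U : Fin k → unitary (Matrix n n ℂ)) : Prop where
  square : IsCommutingSquare S T
  square' : IsCommutingSquare S' T'
  weight_nonneg : ∀ i, 0 ≤ w i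
  weight_sum : ∑ i, w i = 1
  average : ∀ a, condExp R a = ∑ i, (w i : ℂ) • conj (U i) a
  covariant_left : ∀ i a, condExp S (conj (U i) a) = conj (U i) (condExp S a)
  covariant_right : ∀ i a, condExp T (conj (U i) a) = conj (U i) (condExp T a)
  covariant_sup : ∀ i a, condExp (S ⊔ T) (conj (U i) a) = conj (U i) (condExp (S ⊔ T) a)
  covariant_inf : ∀ i a, condExp (S ⊓ T) (conj (U i) a) = conj (U i) (condExp (S ⊓ T) a)
  sup_eq : S' ⊔ T' = S ⊔ T
  left_inf : S' ⊓ R = S ⊓ R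
  right_inf : T' ⊓ R = T ⊓ R
  inf_inf : S' ⊓ T' ⊓ R = S ⊓ T ⊓ R

/-- The pure state `|v⟩⟨v|`. -/
def ketbra (v : n → ℂ) : Matrix n n ℂ := Matrix.vecMulVec v (star v)

end General

/-! Two qubits `A` and `B`, with basis states indexed by pairs of bits. -/

/-- The index type of the computational basis of two qubits. -/
abbrev Qubits : Type := Fin 2 × Fin 2

/-- The Pauli matrix `X`. -/
def pauliX : Matrix (Fin 2) (Fin 2) ℂ := !![0, 1; 1, 0]

/-- The Pauli matrix `Z`. -/
def pauliZ : Matrix (Fin 2) (Fin 2) ℂ := !![1, 0; 0, -1]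

/-- The observable `a` of the qubit `A`. -/
def onA (a : Matrix (Fin 2) (Fin 2) ℂ) : Matrix Qubits Qubits ℂ := a ⊗ₖ 1

/-- The observable `b` of the qubit `B`. -/
def onB (b : Matrix (Fin 2) (Fin 2) ℂ) : Matrix Qubits Qubits ℂ := 1 ⊗ₖ b

/-- The full algebra of the qubit `A`. -/
def algA : Alg Qubits := StarAlgebra.adjoin ℂ (Set.range onA)

/-- The full algebra of the qubit `B`. -/
def algB : Alg Qubits := StarAlgebra.adjoin ℂ (Set.range onB)

/-- `⟨Z_A, Z_B⟩`. -/
def ucrS : Alg Qubits := StarAlgebra.adjoin ℂ {onA pauliZ, onB pauliZ}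

/-- `⟨X_A, X_B⟩`. -/
def ucrT : Alg Qubits := StarAlgebra.adjoin ℂ {onA pauliX, onB pauliX}

/-- `⟨X_A, Z_A Z_B⟩`. -/
def eprS : Alg Qubits := StarAlgebra.adjoin ℂ {onA pauliX, onA pauliZ * onB pauliZ}

/-- `⟨X_A X_B, Z_B⟩`. -/
def eprT : Alg Qubits := StarAlgebra.adjoin ℂ {onA pauliX * onB pauliX, onB pauliZ}

/-- The product vector `|u⟩|v⟩`. -/
def prodKet (u v : Fin 2 → ℂ) : Qubits → ℂ := fun p => u p.1 * v p.2

/-- `1 / √2`. -/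
def invSqrtTwo : ℂ := ((1 / Real.sqrt 2 : ℝ) : ℂ)

/-- `|0⟩`. -/
def ket0 : Fin 2 → ℂ := ![1, 0]

/-- `|1⟩`. -/
def ket1 : Fin 2 → ℂ := ![0, 1]

/-- `|+⟩ = (|0⟩ + |1⟩) / √2`. -/
def ketPlus : Fin 2 → ℂ := invSqrtTwo • (ket0 + ket1)

/-- `|-⟩ = (|0⟩ - |1⟩) / √2`. -/
def ketMinus : Fin 2 → ℂ := invSqrtTwo • (ket0 - ket1)

/-- `|↑_Y⟩ = (|0⟩ + i |1⟩) / √2`. -/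
def ketUpY : Fin 2 → ℂ := invSqrtTwo • (ket0 + Complex.I • ket1)

/-- `|↑_Y ↑_Y⟩`. -/
def ucrKet : Qubits → ℂ := prodKet ketUpY ketUpY

/-- `(|0-⟩ + i |1+⟩) / √2`. -/
def eprKet : Qubits → ℂ :=
  invSqrtTwo • (prodKet ket0 ketMinus + Complex.I • prodKet ket1 ketPlus)

/-- A vector of two qubits is a maximally entangled state: both reduced densities are `1/2`. -/
def IsMaximallyEntangled (v : Qubits → ℂ) : Prop :=
  (∀ a a', ∑ b, ketbra v (a, b) (a', b) = ((1 / 2 : ℂ) • (1 : Matrix (Fin 2) (Fin 2) ℂ)) a a') ∧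
  (∀ b b', ∑ a, ketbra v (a, b) (a, b') = ((1 / 2 : ℂ) • (1 : Matrix (Fin 2) (Fin 2) ℂ)) b b')

end SubalgebraResource

end

open SubalgebraResource

open scoped Matrix Kronecker ComplexOrder

noncomputable section

namespace SubalgebraResource

/-! ### Conditional expectations -/

section CondExp

variable {n : Type} [Fintype n] [DecidableEq n]

/-! Every algebra involved is spanned by two-qubit Pauli operators, so its conditional expectation
is a coordinate projection in the Pauli basis. Commuting squares, commutants and intersections thus
reduce to finite checks on sets of labels (`IsPauliSpan`). The algebra `R` is the commutant of `Y_A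
Y_B`, and `E_R` averages conjugation by `1` and by `Y_A Y_B`. Both pairs meet `R` in the spans of
`1, Z_A Z_B` and of `1, X_A X_B`. The state is fixed by `Y_A` and `Y_B`, hence by `E_R`. Its Pauli
expectations vanish outside `1, Y_A, Y_B, Y_A Y_B`, and of these each of `S, T` in either pair
contains only `1`. So all four reduced states are maximally mixed, and the mutual informations of
the two pairs agree.

For `I_conv` this suffices, because a pure state has only trivial ensembles. For `I_sq` the
extensions must be classified. The centre of `N = S' ∩ T'` lies in both party algebras, whose
intersection is `ℂ1`, so `N` is a factor. A factor splits off from any algebra that contains it,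
hence `S' = ι(S) N` and `T' = ι(T) N` (`IsExtension.exists_isTensorExtension`); conversely every
such configuration is an extension (`IsTensorExtension.isExtension`). An extension of a pure state
is a product `ι(ρ) D` with `D ∈ N`, so its entropies depend on `S, T` only through `E_S(ρ), E_T(ρ)`
(`Isq_le_Isq_of_pure`).

For the averaging of arbitrary densities, `I_conv` is treated by conjugating the members of an
ensemble. For `I_sq` a register that records the unitary is put into `N` (`Isq_average_le`); it
shifts all four entropies by the same amount, and the shifts cancel. The renaming is a controlled
negation, which turns the generators of the second pair into local Pauli operators. -/

theorem condExp_eq {N : Alg n} {a e : Matrix n n ℂ} (he : e ∈ N)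
    (h : ∀ b ∈ N, (e * b).trace = (a * b).trace) : condExp N a = e :=
  (exists_unique_condExp N a).unique
    ⟨condExp_mem N a, fun _ hb => trace_condExp_mul N a hb⟩ ⟨he, h⟩

theorem condExp_of_mem {N : Alg n} {a : Matrix n n ℂ} (ha : a ∈ N) : condExp N a = a :=
  condExp_eq ha fun _ _ => rfl

theorem condExp_add (N : Alg n) (a b : Matrix n n ℂ) :
    condExp N (a + b) = condExp N a + condExp N b :=
  condExp_eq (add_mem (condExp_mem N a) (condExp_mem N b)) fun c hc => by
    rw [add_mul, add_mul, Matrix.trace_add, Matrix.trace_add, trace_condExp_mul N a hc,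
      trace_condExp_mul N b hc]

theorem condExp_smul (N : Alg n) (c : ℂ) (a : Matrix n n ℂ) :
    condExp N (c • a) = c • condExp N a :=
  condExp_eq (N.smul_mem (condExp_mem N a) c) fun b hb => by
    rw [smul_mul_assoc, smul_mul_assoc, Matrix.trace_smul, Matrix.trace_smul,
      trace_condExp_mul N a hb]

theorem condExp_star (N : Alg n) (a : Matrix n n ℂ) :
    condExp N (star a) = star (condExp N a) :=
  condExp_eq (star_mem (condExp_mem N a)) fun b hb => by
    have h := congrArg star (trace_condExp_mul N a (star_mem hb))
    rw [← Matrix.trace_conjTranspose, ← Matrix.trace_conjTranspose,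
      ← Matrix.star_eq_conjTranspose, ← Matrix.star_eq_conjTranspose, star_mul, star_mul,
      star_star] at h
    rw [Matrix.trace_mul_comm, h, Matrix.trace_mul_comm]

theorem condExp_condExp_of_le {A B : Alg n} (h : A ≤ B) (a : Matrix n n ℂ) :
    condExp A (condExp B a) = condExp A a :=
  (condExp_eq (condExp_mem A _) fun b hb => by
    rw [trace_condExp_mul A _ hb, trace_condExp_mul B a (h hb)]).symm

theorem trace_condExp (N : Alg n) (a : Matrix n n ℂ) : (condExp N a).trace = a.trace := by
  simpa using trace_condExp_mul N a (one_mem N)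

end CondExp

/-! ### Transport along trace-preserving isomorphisms -/

section Transport

open scoped MatrixOrder in
theorem exists_eq_star_mul_self {n : Type} [Fintype n] {a : Matrix n n ℂ} (ha : a.PosSemidef) :
    ∃ b : Matrix n n ℂ, a = star b * b := by
  classical exact CStarAlgebra.nonneg_iff_eq_star_mul_self.1 ha.nonneg

variable {n κ : Type} [Fintype n] [DecidableEq n] [Fintype κ] [DecidableEq κ]

theorem continuous_starAlgHom (φ : Matrix n n ℂ →⋆ₐ[ℂ] Matrix κ κ ℂ) : Continuous φ :=
  φ.toAlgHom.toLinearMap.continuous_of_finiteDimensional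

/-- The spectrum of a matrix is finite, so any `f` is continuous on it. -/
theorem map_cfc_matrix (φ : Matrix n n ℂ →⋆ₐ[ℂ] Matrix κ κ ℂ) (f : ℝ → ℝ)
    {a : Matrix n n ℂ} (ha : IsSelfAdjoint a) : φ (cfc f a) = cfc f (φ a) :=
  StarAlgHomClass.map_cfc (S := ℂ) φ f a (hf := (Matrix.finite_real_spectrum (A := a)).continuousOn f)
    (hφ := continuous_starAlgHom φ) (ha := ha) (hφa := ha.map φ)

/-- A trace-preserving `*`-isomorphism of full matrix algebras. -/
structure IsTraceIso (φ : Matrix n n ℂ →⋆ₐ[ℂ] Matrix κ κ ℂ) : Prop where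
  surjective : Function.Surjective φ
  trace : ∀ a, (φ a).trace = a.trace

variable {φ : Matrix n n ℂ →⋆ₐ[ℂ] Matrix κ κ ℂ}

/-- The trace is faithful: if `φ a = 0`, then `a * aᴴ` has trace zero. -/
theorem IsTraceIso.injective (hφ : IsTraceIso φ) : Function.Injective φ := by
  rw [injective_iff_map_eq_zero]
  intro a ha
  refine Matrix.trace_mul_conjTranspose_self_eq_zero_iff.1 ?_
  rw [← hφ.trace, map_mul, ha, zero_mul, Matrix.trace_zero]

theorem IsTraceIso.condExp_map (hφ : IsTraceIso φ) (N : Alg n) (a : Matrix n n ℂ) :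
    condExp (N.map φ) (φ a) = φ (condExp N a) := by
  refine condExp_eq (StarSubalgebra.mem_map.2 ⟨_, condExp_mem N a, rfl⟩) ?_
  rintro _ ⟨b, hb, rfl⟩
  change (φ _ * φ b).trace = (φ _ * φ b).trace
  rw [← map_mul, ← map_mul, hφ.trace, hφ.trace, trace_condExp_mul N a hb]

theorem IsTraceIso.vonNeumannEntropy_map (hφ : IsTraceIso φ) {a : Matrix n n ℂ}
    (ha : IsSelfAdjoint a) : vonNeumannEntropy (φ a) = vonNeumannEntropy a := by
  rw [vonNeumannEntropy, ← map_cfc_matrix φ _ ha, hφ.trace, vonNeumannEntropy]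

theorem isSelfAdjoint_condExp (N : Alg n) {a : Matrix n n ℂ} (ha : IsSelfAdjoint a) :
    IsSelfAdjoint (condExp N a) := by
  rw [IsSelfAdjoint, ← condExp_star, ha.star_eq]

theorem IsTraceIso.algEntropy_map (hφ : IsTraceIso φ) (N : Alg n) {a : Matrix n n ℂ}
    (ha : IsSelfAdjoint a) : algEntropy (N.map φ) (φ a) = algEntropy N a := by
  rw [algEntropy, hφ.condExp_map, hφ.vonNeumannEntropy_map (isSelfAdjoint_condExp N ha), algEntropy]

theorem IsTraceIso.mutualInfo_map (hφ : IsTraceIso φ) (S T : Alg n) {a : Matrix n n ℂ}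
    (ha : IsSelfAdjoint a) : mutualInfo (S.map φ) (T.map φ) (φ a) = mutualInfo S T a := by
  rw [mutualInfo, ← StarSubalgebra.map_sup, ← StarSubalgebra.map_inf φ hφ.injective]
  simp only [hφ.algEntropy_map _ ha, mutualInfo]

theorem IsTraceIso.isDensity_map (hφ : IsTraceIso φ) {a : Matrix n n ℂ} (ha : IsDensity a) :
    IsDensity (φ a) := by
  refine ⟨?_, by rw [hφ.trace, ha.2]⟩
  obtain ⟨b, hb⟩ := exists_eq_star_mul_self ha.1
  rw [hb, map_mul, map_star]
  exact Matrix.posSemidef_conjTranspose_mul_self _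

theorem IsDensity.isSelfAdjoint {a : Matrix n n ℂ} (ha : IsDensity a) : IsSelfAdjoint a :=
  ha.1.isHermitian

theorem isTraceIso_conj (U : unitary (Matrix n n ℂ)) : IsTraceIso (conj U) where
  surjective := (Unitary.conjStarAlgAut ℂ (Matrix n n ℂ) U).surjective
  trace a := by
    change ((U : Matrix n n ℂ) * a * star (U : Matrix n n ℂ)).trace = _
    rw [Matrix.trace_mul_comm, ← mul_assoc, Unitary.coe_star_mul_self, one_mul]

theorem conj_apply (U : unitary (Matrix n n ℂ)) (a : Matrix n n ℂ) :
    conj U a = (U : Matrix n n ℂ) * a * star (U : Matrix n n ℂ) := rfl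

theorem conj_star_conj (U : unitary (Matrix n n ℂ)) (a : Matrix n n ℂ) :
    conj (star U) (conj U a) = a := by
  simp only [conj_apply, Unitary.coe_star, star_star, ← mul_assoc, Unitary.coe_star_mul_self, one_mul]
  rw [mul_assoc, Unitary.coe_star_mul_self, mul_one]

theorem conj_conj_star (U : unitary (Matrix n n ℂ)) (a : Matrix n n ℂ) :
    conj U (conj (star U) a) = a := by
  simpa using conj_star_conj (star U) a

theorem map_conj_eq {U : unitary (Matrix n n ℂ)} {A : Alg n} (h : ∀ a ∈ A, conj U a ∈ A)
    (h' : ∀ a ∈ A, conj (star U) a ∈ A) : A.map (conj U) = A := by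
  refine le_antisymm ?_ fun a ha => ⟨_, h' a ha, conj_conj_star U a⟩
  rintro _ ⟨a, ha, rfl⟩
  exact h a ha

theorem map_conj_star_eq {U : unitary (Matrix n n ℂ)} {A B : Alg n} (h : A.map (conj U) = B) :
    B.map (conj (star U)) = A := by
  subst h
  ext a
  constructor
  · rintro ⟨_, ⟨b, hb, rfl⟩, rfl⟩
    exact (conj_star_conj U b).symm ▸ hb
  · exact fun ha => ⟨_, ⟨a, ha, rfl⟩, conj_star_conj U a⟩

theorem condExp_conj {U : unitary (Matrix n n ℂ)} {A : Alg n} (h : A.map (conj U) = A)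
    (a : Matrix n n ℂ) : condExp A (conj U a) = conj U (condExp A a) := by
  conv_lhs => rw [← h]
  exact (isTraceIso_conj U).condExp_map A a

theorem mutualInfo_conj {U : unitary (Matrix n n ℂ)} {S T : Alg n} (hS : S.map (conj U) = S)
    (hT : T.map (conj U) = T) {a : Matrix n n ℂ} (ha : IsSelfAdjoint a) :
    mutualInfo S T (conj U a) = mutualInfo S T a := by
  conv_lhs => rw [← hS, ← hT]
  exact (isTraceIso_conj U).mutualInfo_map S T ha

end Transport

/-! ### Uniqueness of the trace -/

section TracialFunctional

variable {n : Type} [Fintype n] [DecidableEq n]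

/-- Up to scaling, the trace is the only tracial functional on a matrix algebra. -/
theorem card_mul_eq_trace_mul (τ : Matrix n n ℂ →ₗ[ℂ] ℂ) (h : ∀ a b, τ (a * b) = τ (b * a))
    (a : Matrix n n ℂ) : (Fintype.card n : ℂ) * τ a = a.trace * τ 1 := by
  -- Write `E_ij = E_ik E_kj`; traciality turns this into `E_kj E_ik`, which is `0` or `E_kk`.
  have h0 : ∀ i j k : n, τ (Matrix.single i j 1) = if i = j then τ (Matrix.single k k 1) else 0 := by
    intro i j k
    have h1 : Matrix.single i j (1 : ℂ) = Matrix.single i k 1 * Matrix.single k j 1 := by simp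
    rw [h1, h]
    split_ifs with hij
    · subst hij; simp
    · rw [Matrix.single_mul_single_of_ne _ _ _ _ (Ne.symm hij), map_zero]
  have h1 : ∀ (b : Matrix n n ℂ) (k : n), τ b = b.trace * τ (Matrix.single k k 1) := by
    intro b k
    conv_lhs => rw [Matrix.matrix_eq_sum_single b]
    simp only [map_sum, Matrix.trace, Matrix.diag, Finset.sum_mul]
    refine Finset.sum_congr rfl fun i _ => ?_
    have : ∀ j, τ (Matrix.single i j (b i j)) =
        if i = j then b i j * τ (Matrix.single k k 1) else 0 := by
      intro j
      have : Matrix.single i j (b i j) = b i j • Matrix.single i j (1 : ℂ) := by simp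
      rw [this, map_smul, h0 i j k]
      split_ifs <;> simp
    simp [this]
  rcases isEmpty_or_nonempty n with hn | ⟨⟨k⟩⟩
  · simp [Matrix.trace]
  · rw [h1 a k, h1 1 k, Matrix.trace_one]
    ring

end TracialFunctional

/-! ### Projections and pure states -/

section Projection

variable {n : Type} [Fintype n] [DecidableEq n]

theorem trace_mul_projection {A q : Matrix n n ℂ} (hq : IsStarProjection q) :
    (A * q).trace = (star q * A * q).trace := by
  rw [Matrix.trace_mul_comm (star q * A), ← mul_assoc, hq.isSelfAdjoint.star_eq, hq.isIdempotentElem.eq,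
    Matrix.trace_mul_comm]

theorem _root_.Matrix.PosSemidef.trace_mul_projection_nonneg {A q : Matrix n n ℂ}
    (hA : A.PosSemidef) (hq : IsStarProjection q) : 0 ≤ (A * q).trace := by
  rw [trace_mul_projection hq]
  exact (hA.conjTranspose_mul_mul_same q).trace_nonneg

/-- With `A = b* b` the trace is that of `(b q)* (b q)`, so `b q = 0`. -/
theorem _root_.Matrix.PosSemidef.mul_projection_eq_zero {A q : Matrix n n ℂ}
    (hA : A.PosSemidef) (hq : IsStarProjection q) (h : (A * q).trace = 0) : A * q = 0 := by
  rw [trace_mul_projection hq] at h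
  have h1 := ((hA.conjTranspose_mul_mul_same q).trace_eq_zero_iff).1 h
  obtain ⟨b, rfl⟩ := exists_eq_star_mul_self hA
  have h2 : (b * q)ᴴ * (b * q) = 0 := by
    rw [Matrix.conjTranspose_mul]
    simpa only [mul_assoc, Matrix.star_eq_conjTranspose] using h1
  rw [mul_assoc, Matrix.conjTranspose_mul_self_eq_zero.1 h2, mul_zero]

theorem isStarProjection_ketbra {v : n → ℂ} (hv : star v ⬝ᵥ v = 1) :
    IsStarProjection (ketbra v) where
  isIdempotentElem := by
    rw [IsIdempotentElem, ketbra, Matrix.vecMulVec_mul_vecMulVec, hv, one_smul]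
  isSelfAdjoint := by
    rw [IsSelfAdjoint, Matrix.star_eq_conjTranspose, ketbra, Matrix.conjTranspose_vecMulVec, star_star]

theorem ketbra_mul_mul_ketbra (v : n → ℂ) (a : Matrix n n ℂ) :
    ketbra v * a * ketbra v = (ketbra v * a).trace • ketbra v := by
  rw [ketbra, Matrix.vecMulVec_mul, Matrix.vecMulVec_mul_vecMulVec, Matrix.trace_vecMulVec,
    dotProduct_comm, Matrix.vecMulVec_smul]

theorem isDensity_ketbra {v : n → ℂ} (hv : star v ⬝ᵥ v = 1) : IsDensity (ketbra v) :=
  ⟨Matrix.posSemidef_vecMulVec_self_star v, by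
    rw [ketbra, Matrix.trace_vecMulVec, dotProduct_comm, hv]⟩

/-- A density whose expectation in the projection `p` is one is supported by `p`. -/
theorem IsDensity.mul_projection {ρ p : Matrix n n ℂ} (hρ : IsDensity ρ) (hp : IsStarProjection p)
    (h : (ρ * p).trace = 1) : ρ * p = ρ ∧ p * ρ = ρ := by
  have h1 : ρ * p = ρ := by
    have := hρ.1.mul_projection_eq_zero hp.one_sub
      (by rw [mul_sub, mul_one, Matrix.trace_sub, h, hρ.2, sub_self])
    rw [mul_sub, mul_one, sub_eq_zero] at this
    exact this.symm
  refine ⟨h1, ?_⟩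
  have h2 := congrArg star h1
  rwa [star_mul, hp.isSelfAdjoint.star_eq, hρ.isSelfAdjoint.star_eq] at h2

/-- Pure states are extreme among the densities. -/
theorem eq_ketbra_of_sum_eq {v : n → ℂ} (hv : star v ⬝ᵥ v = 1) {k : ℕ} {p : Fin k → ℝ}
    {σ : Fin k → Matrix n n ℂ} (hp : ∀ i, 0 ≤ p i) (hσ : ∀ i, IsDensity (σ i))
    (h : ∑ i, (p i : ℂ) • σ i = ketbra v) {i : Fin k} (hi : p i ≠ 0) : σ i = ketbra v := by
  have hP := isStarProjection_ketbra hv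
  -- The complementary projection has expectation zero in the average, hence in each member of
  -- nonzero weight, as all terms are nonnegative.
  have h1 : ∑ i, (p i : ℂ) * (σ i * (1 - ketbra v)).trace = 0 := by
    have := congrArg (fun a => (a * (1 - ketbra v)).trace) h
    simpa [Finset.sum_mul, Matrix.trace_sum, mul_sub, hP.isIdempotentElem.eq] using this
  have h2 := (Finset.sum_eq_zero_iff_of_nonneg fun j _ => mul_nonneg
    (Complex.zero_le_real.2 (hp j)) ((hσ j).1.trace_mul_projection_nonneg hP.one_sub)).1 h1 i
      (Finset.mem_univ i)
  have h3 : (σ i * ketbra v).trace = 1 := by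
    have := (mul_eq_zero.1 h2).resolve_left (by exact_mod_cast hi)
    rw [mul_sub, mul_one, Matrix.trace_sub, (hσ i).2, sub_eq_zero] at this
    exact this.symm
  obtain ⟨h4, h5⟩ := (hσ i).mul_projection hP h3
  have h6 := ketbra_mul_mul_ketbra v (σ i)
  rw [h5, h4, (hσ i).2, one_smul] at h6
  exact h6

end Projection

/-! ### Factors inside a matrix algebra -/

section Factor

variable {n : Type} [Fintype n] [DecidableEq n]

theorem mem_commutant_iff {N : Alg n} {z : Matrix n n ℂ} :
    z ∈ commutant N ↔ ∀ a ∈ N, a * z = z * a := by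
  rw [commutant, StarSubalgebra.mem_centralizer_iff]
  exact ⟨fun h a ha => (h a ha).1, fun h a ha => ⟨h a ha, h _ (star_mem ha)⟩⟩

theorem mem_bot_iff_exists_smul {z : Matrix n n ℂ} :
    z ∈ (⊥ : Alg n) ↔ ∃ c : ℂ, z = c • 1 := by
  rw [StarSubalgebra.mem_bot]
  simp only [Set.mem_range, Algebra.algebraMap_eq_smul_one, eq_comm]

/-- A subalgebra of `M_n(ℂ)` with trivial centre. -/
def IsFactor (N : Alg n) : Prop := N ⊓ commutant N = ⊥

theorem IsFactor.exists_eq_smul {N : Alg n} (h : IsFactor N) {z : Matrix n n ℂ} (hz : z ∈ N)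
    (hc : ∀ a ∈ N, a * z = z * a) : ∃ c : ℂ, z = c • 1 := by
  rw [← mem_bot_iff_exists_smul, ← h]
  exact ⟨hz, mem_commutant_iff.2 hc⟩

/-- A subalgebra with trivial centre has no proper two-sided ideals: the annihilator of an ideal for
the trace form is a complementary ideal, and the resulting decomposition of `1` is central. -/
theorem IsFactor.isSimpleRing [Nonempty n] {N : Alg n} (h : IsFactor N) : IsSimpleRing N := by
  have htr : ∀ x : Matrix n n ℂ, (star x * x).trace = 0 → x = 0 := fun x hx =>
    Matrix.trace_conjTranspose_mul_self_eq_zero_iff.1 hx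
  suffices hI : ∀ I : TwoSidedIdeal N, I = ⊥ ∨ I = ⊤ from
    ⟨{ eq_bot_or_eq_top := hI }⟩
  intro I
  let W : Submodule ℂ (Matrix n n ℂ) :=
    { carrier := {x | ∃ h : x ∈ N, (⟨x, h⟩ : N) ∈ I}
      add_mem' := fun ⟨ha, ha'⟩ ⟨hb, hb'⟩ => ⟨add_mem ha hb, I.add_mem ha' hb'⟩
      zero_mem' := ⟨zero_mem N, I.zero_mem⟩
      smul_mem' := fun c x ⟨hx, hx'⟩ => ⟨N.smul_mem hx c, by
        have := I.mul_mem_left (algebraMap ℂ N c) _ hx'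
        rwa [← Algebra.smul_def] at this⟩ }
  -- The trace form is nondegenerate on the ideal: the test element `x* x x*` gives the squared norm
  -- of `x* x`.
  have hnd : ∀ x ∈ I, (∀ y ∈ I, ((x : Matrix n n ℂ) * y).trace = 0) → x = 0 := by
    intro x hx hy
    have h1 := hy (star x * (x * star x)) (I.mul_mem_left _ _ (I.mul_mem_right _ _ hx))
    have h2 : star (x : Matrix n n ℂ) * x = 0 := by
      apply htr
      rw [star_mul, star_star, mul_assoc, Matrix.trace_mul_comm]
      simpa [mul_assoc] using h1
    exact Subtype.ext (htr _ (by rw [h2, Matrix.trace_zero]))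
  let tr2 : Matrix n n ℂ →ₗ[ℂ] Matrix n n ℂ →ₗ[ℂ] ℂ :=
    (LinearMap.mul ℂ (Matrix n n ℂ)).compr₂ (Matrix.traceLinearMap n ℂ ℂ)
  let f : W →ₗ[ℂ] Module.Dual ℂ W := tr2.domRestrict₁₂ W W
  have hf : Function.Injective f := by
    rw [← LinearMap.ker_eq_bot, LinearMap.ker_eq_bot']
    rintro ⟨x, hx, hxI⟩ h0
    have h1 := hnd _ hxI fun b hb => LinearMap.congr_fun h0 ⟨b, b.2, hb⟩
    exact Subtype.ext (congrArg (fun z : N => (z : Matrix n n ℂ)) h1)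
  have hs : Function.Surjective f :=
    (LinearMap.injective_iff_surjective_of_finrank_eq_finrank
      (Subspace.dual_finrank_eq (K := ℂ) (V := W)).symm).1 hf
  -- The element of the ideal that represents the trace on it is the component of `1` in the ideal.
  -- It is central, hence a scalar, and the scalar decides between `⊥` and `⊤`.
  obtain ⟨⟨e₀, he₀, heI⟩, he⟩ := hs ((tr2 1).comp W.subtype)
  let e : {x : N // x ∈ I} := ⟨⟨e₀, he₀⟩, heI⟩
  have he' : ∀ b ∈ I, ((e.1 : Matrix n n ℂ) * b).trace = (b : Matrix n n ℂ).trace := fun b hb => by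
    have : tr2 e₀ b = tr2 1 b := LinearMap.congr_fun he ⟨b, b.2, hb⟩
    simpa [tr2] using this
  have hcomm : ∀ a : N, a * e.1 = e.1 * a := by
    intro a
    refine sub_eq_zero.1 (hnd _ (I.sub_mem (I.mul_mem_left _ _ e.2) (I.mul_mem_right _ _ e.2))
      fun y hy => ?_)
    have h1 := he' (y * a) (I.mul_mem_right _ _ hy)
    have h2 := he' (a * y) (I.mul_mem_left _ _ hy)
    simp only [MulMemClass.coe_mul, AddSubgroupClass.coe_sub] at h1 h2 ⊢
    rw [sub_mul, Matrix.trace_sub, mul_assoc, mul_assoc, h2, Matrix.trace_mul_comm, mul_assoc, h1,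
      Matrix.trace_mul_comm, sub_self]
  obtain ⟨c, hc⟩ := h.exists_eq_smul e.1.2 fun a ha => congrArg Subtype.val (hcomm ⟨a, ha⟩)
  have hc' : e.1 = c • (1 : N) := Subtype.ext hc
  by_cases h0 : c = 0
  · left
    refine le_bot_iff.1 fun b hb => ?_
    have hb0 : b = 0 := hnd b hb fun y hy => by
      have := he' (b * y) (I.mul_mem_right _ _ hb)
      rwa [hc', h0, zero_smul, ZeroMemClass.coe_zero, zero_mul, Matrix.trace_zero, eq_comm] at this
    exact hb0
  · right
    rw [← I.one_mem_iff]
    have := I.mul_mem_left (algebraMap ℂ N c⁻¹) _ e.2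
    rwa [← Algebra.smul_def, hc', smul_smul, inv_mul_cancel₀ h0, one_smul] at this

/-- A factor has a system of matrix units. -/
theorem IsFactor.exists_matrixUnits [Nonempty n] {N : Alg n} (h : IsFactor N) :
    ∃ (k : ℕ) (_ : NeZero k) (e : Fin k → Fin k → Matrix n n ℂ), (∀ i j, e i j ∈ N) ∧
      (∀ i j l r, e i j * e l r = if j = l then e i r else 0) ∧ ∑ i, e i i = 1 ∧
      ∀ a ∈ N, ∃ c : Fin k → Fin k → ℂ, a = ∑ i, ∑ j, c i j • e i j := by
  have := h.isSimpleRing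
  have : FiniteDimensional ℂ N :=
    inferInstanceAs (FiniteDimensional ℂ N.toSubalgebra.toSubmodule)
  -- The Wedderburn isomorphism need not respect `star`; adjoints of the matrix units are never
  -- used.
  obtain ⟨k, hk, ⟨φ⟩⟩ := IsSimpleRing.exists_algEquiv_matrix_of_isAlgClosed ℂ N
  refine ⟨k, hk, fun i j => φ.symm (Matrix.single i j 1), fun i j => Subtype.property _, ?_, ?_, ?_⟩
  · intro i j l r
    rw [← MulMemClass.coe_mul, ← map_mul]
    split_ifs with hjl
    · subst hjl; simp
    · rw [Matrix.single_mul_single_of_ne _ _ _ _ hjl, map_zero, ZeroMemClass.coe_zero]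
  · rw [← AddSubmonoidClass.coe_finsetSum, ← map_sum, Matrix.sum_single_one, map_one]
    rfl
  · intro a ha
    refine ⟨fun i j => φ ⟨a, ha⟩ i j, ?_⟩
    have h1 : (⟨a, ha⟩ : N) = φ.symm (∑ i, ∑ j, φ ⟨a, ha⟩ i j • Matrix.single i j 1) := by
      rw [AlgEquiv.eq_symm_apply]
      conv_lhs => rw [Matrix.matrix_eq_sum_single (φ ⟨a, ha⟩)]
      simp
    have h2 := congrArg (N.subtype) h1
    simpa only [map_sum, map_smul, StarSubalgebra.subtype_apply] using h2

/-- These slices are the coefficients of `x` with respect to the matrix units. Multiplication by `e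
s t` on either side leaves a single term, `e s i * x * e j t` in both cases. -/
theorem matrixUnits_slice_comm {N : Alg n} {k : ℕ} {e : Fin k → Fin k → Matrix n n ℂ}
    (hmul : ∀ i j l r, e i j * e l r = if j = l then e i r else 0)
    (hspan : ∀ a ∈ N, ∃ c : Fin k → Fin k → ℂ, a = ∑ i, ∑ j, c i j • e i j) (x : Matrix n n ℂ)
    (i j : Fin k) (a : Matrix n n ℂ) (ha : a ∈ N) :
    a * (∑ r, e r i * x * e j r) = (∑ r, e r i * x * e j r) * a := by
  have h1 : ∀ s t, e s t * (∑ r, e r i * x * e j r) = (∑ r, e r i * x * e j r) * e s t := by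
    intro s t
    rw [Finset.mul_sum, Finset.sum_mul, Finset.sum_eq_single t, Finset.sum_eq_single s]
    · rw [← mul_assoc, ← mul_assoc, hmul, if_pos rfl, mul_assoc _ _ (e s t), hmul, if_pos rfl]
    · intro r _ hr
      rw [mul_assoc, hmul, if_neg hr, mul_zero]
    · simp
    · intro r _ hr
      rw [← mul_assoc, ← mul_assoc, hmul, if_neg hr.symm, zero_mul, zero_mul]
    · simp
  obtain ⟨c, rfl⟩ := hspan a ha
  rw [Finset.sum_mul, Finset.mul_sum]
  refine Finset.sum_congr rfl fun s _ => ?_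
  rw [Finset.sum_mul, Finset.mul_sum]
  refine Finset.sum_congr rfl fun t _ => ?_
  rw [smul_mul_assoc, mul_smul_comm, h1]

/-- A subalgebra that contains a factor `N` is generated by `N` and its relative commutant. -/
theorem IsFactor.eq_commutant_sup [Nonempty n] {N A : Alg n} (h : IsFactor N) (hN : N ≤ A) :
    A = (A ⊓ commutant N) ⊔ N := by
  obtain ⟨k, _, e, he, hmul, hone, hspan⟩ := h.exists_matrixUnits
  refine le_antisymm (fun x hx => ?_) (sup_le inf_le_left hN)
  -- Expand `x = ∑ e_ii x e_jj`; each term is a slice times `e_ij`.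
  have hx' : x = ∑ i, ∑ j, (∑ r, e r i * x * e j r) * e i j := by
    have h1 : ∀ i j, (∑ r, e r i * x * e j r) * e i j = e i i * x * e j j := fun i j => by
      rw [Finset.sum_mul, Finset.sum_eq_single i]
      · rw [mul_assoc, hmul, if_pos rfl]
      · intro r _ hr
        rw [mul_assoc, hmul, if_neg hr, mul_zero]
      · simp
    simp_rw [h1, ← Finset.mul_sum, ← Finset.sum_mul, hone, one_mul, mul_one]
  rw [hx']
  refine sum_mem fun i _ => sum_mem fun j _ => StarSubalgebra.mul_mem_sup ⟨?_, ?_⟩ (he i j)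
  · exact sum_mem fun r _ => mul_mem (mul_mem (hN (he r i)) hx) (hN (he j r))
  · exact mem_commutant_iff.2 (matrixUnits_slice_comm hmul hspan x i j)

end Factor

/-! ### The algebras `ι(A) N` for a factor `N` -/

section Amplification

variable {n κ : Type} [Fintype n] [DecidableEq n] [Fintype κ] [DecidableEq κ]

/-- An embedding of `M_n(ℂ)` together with a factor that commutes with its range. -/
structure IsTensorPair (ι : Matrix n n ℂ →⋆ₐ[ℂ] Matrix κ κ ℂ) (N : Alg κ) : Prop where
  injective : Function.Injective ι
  commute : ∀ a, ∀ b ∈ N, ι a * b = b * ι a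
  factor : IsFactor N

/-- The subalgebra `ι(A) N`. -/
abbrev amp (ι : Matrix n n ℂ →⋆ₐ[ℂ] Matrix κ κ ℂ) (N : Alg κ) (A : Alg n) : Alg κ := A.map ι ⊔ N

variable {ι : Matrix n n ℂ →⋆ₐ[ℂ] Matrix κ κ ℂ} {N : Alg κ}

/-- As `N` commutes with the range of `ι`, the span of the products is already a unital `*`-algebra.
-/
theorem IsTensorPair.mem_span (h : IsTensorPair ι N) {A : Alg n} {x : Matrix κ κ ℂ}
    (hx : x ∈ amp ι N A) :
    x ∈ Submodule.span ℂ {y | ∃ a ∈ A, ∃ b ∈ N, y = ι a * b} := by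
  set s : Set (Matrix κ κ ℂ) := {y | ∃ a ∈ A, ∃ b ∈ N, y = ι a * b} with hs
  have hmul : ∀ x ∈ Submodule.span ℂ s, ∀ y ∈ Submodule.span ℂ s, x * y ∈ Submodule.span ℂ s := by
    intro x hx y hy
    refine Submodule.span_induction₂ (p := fun x y _ _ => x * y ∈ Submodule.span ℂ s)
      ?_ ?_ ?_ ?_ ?_ ?_ ?_ hx hy
    · rintro _ _ ⟨a, ha, b, hb, rfl⟩ ⟨c, hc, d, hd, rfl⟩
      refine Submodule.subset_span ⟨a * c, mul_mem ha hc, b * d, mul_mem hb hd, ?_⟩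
      rw [map_mul, mul_assoc, ← mul_assoc b, ← h.commute c b hb]
      simp only [mul_assoc]
    · simp
    · simp
    · intro x y z _ _ _ h1 h2; rw [add_mul]; exact add_mem h1 h2
    · intro x y z _ _ _ h1 h2; rw [mul_add]; exact add_mem h1 h2
    · intro r x y _ _ h1; rw [smul_mul_assoc]; exact Submodule.smul_mem _ _ h1
    · intro r x y _ _ h1; rw [mul_smul_comm]; exact Submodule.smul_mem _ _ h1
  have hone : (1 : Matrix κ κ ℂ) ∈ Submodule.span ℂ s :=
    Submodule.subset_span ⟨1, one_mem A, 1, one_mem N, by rw [map_one, one_mul]⟩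
  let B : Alg κ :=
    { carrier := Submodule.span ℂ s
      mul_mem' := fun {x y} hx hy => hmul x hx y hy
      one_mem' := hone
      add_mem' := add_mem
      zero_mem' := zero_mem _
      algebraMap_mem' := fun r => by
        rw [Algebra.algebraMap_eq_smul_one]; exact Submodule.smul_mem _ _ hone
      star_mem' := fun {x} hx => by
        refine Submodule.span_induction (p := fun x _ => star x ∈ Submodule.span ℂ s)
          ?_ ?_ ?_ ?_ hx
        · rintro _ ⟨a, ha, b, hb, rfl⟩
          refine Submodule.subset_span ⟨star a, star_mem ha, star b, star_mem hb, ?_⟩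
          rw [star_mul, map_star, ← map_star, h.commute _ _ (star_mem hb)]
        · simp
        · intro x y _ _ h1 h2; rw [star_add]; exact add_mem h1 h2
        · intro r x _ h1; rw [star_smul]; exact Submodule.smul_mem _ _ h1 }
  have hle : amp ι N A ≤ B := by
    refine sup_le ?_ fun b hb => Submodule.subset_span ⟨1, one_mem A, b, hb, ?_⟩
    · rintro _ ⟨a, ha, rfl⟩
      exact Submodule.subset_span ⟨a, ha, 1, one_mem N, (mul_one _).symm⟩
    · rw [map_one, one_mul]
  exact hle hx

/-- Scalars are absorbed into the factor `a`, so additivity is the only closure property to be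
checked. -/
theorem IsTensorPair.amp_induction (h : IsTensorPair ι N) {A : Alg n}
    {p : Matrix κ κ ℂ → Prop} (mul : ∀ a ∈ A, ∀ b ∈ N, p (ι a * b))
    (add : ∀ x y, p x → p y → p (x + y)) {x : Matrix κ κ ℂ} (hx : x ∈ amp ι N A) : p x := by
  have h0 : p 0 := by simpa using mul 0 (zero_mem A) 0 (zero_mem N)
  have hsm : ∀ r : ℂ, p (r • x) := by
    refine Submodule.span_induction (p := fun x _ => ∀ r : ℂ, p (r • x)) ?_ ?_ ?_ ?_ (h.mem_span hx)
    · rintro _ ⟨a, ha, b, hb, rfl⟩ r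
      simpa using mul (r • a) (A.smul_mem ha r) b hb
    · simpa using h0
    · intro x y _ _ hx hy r
      rw [smul_add]
      exact add _ _ (hx r) (hy r)
    · intro s x _ hx r
      rw [smul_smul]
      exact hx _
  simpa using hsm 1

theorem mul_mem_amp {A : Alg n} {a : Matrix n n ℂ} (ha : a ∈ A) {b : Matrix κ κ ℂ} (hb : b ∈ N) :
    ι a * b ∈ amp ι N A :=
  StarSubalgebra.mul_mem_sup ⟨a, ha, rfl⟩ hb

theorem amp_mono {A B : Alg n} (hAB : A ≤ B) : amp ι N A ≤ amp ι N B :=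
  sup_le_sup_right (StarSubalgebra.map_mono hAB) N

theorem amp_sup (A B : Alg n) : amp ι N A ⊔ amp ι N B = amp ι N (A ⊔ B) := by
  rw [amp, amp, amp, StarSubalgebra.map_sup, ← sup_sup_distrib_right]

/-- The functional `a ↦ tr (ι(a) b)` is tracial because `b` commutes with the range of `ι`, so it is
a multiple of the trace. This is the product form of the trace on `ι(M_n) N`. -/
theorem IsTensorPair.card_mul_trace (h : IsTensorPair ι N) (a : Matrix n n ℂ) {b : Matrix κ κ ℂ}
    (hb : b ∈ N) : (Fintype.card n : ℂ) * (ι a * b).trace = a.trace * b.trace := by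
  let τ : Matrix n n ℂ →ₗ[ℂ] ℂ :=
    (Matrix.traceLinearMap κ ℂ ℂ) ∘ₗ (LinearMap.mulRight ℂ b) ∘ₗ ι.toAlgHom.toLinearMap
  have hτ : ∀ a, τ a = (ι a * b).trace := fun _ => rfl
  have := card_mul_eq_trace_mul τ (fun c d => by
    rw [hτ, hτ, map_mul, map_mul, mul_assoc, Matrix.trace_mul_comm, mul_assoc, ← h.commute c b hb,
      mul_assoc]) a
  simpa [hτ] using this

/-- The trace factorizes on products, so the expectation acts as `E_A ⊗ id`. -/
theorem IsTensorPair.condExp_amp [Nonempty n] (h : IsTensorPair ι N) (A : Alg n)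
    (a : Matrix n n ℂ) {b : Matrix κ κ ℂ} (hb : b ∈ N) :
    condExp (amp ι N A) (ι a * b) = ι (condExp A a) * b := by
  refine condExp_eq (mul_mem_amp (condExp_mem A a) hb) fun x hx => ?_
  refine h.amp_induction (p := fun x => (ι (condExp A a) * b * x).trace = (ι a * b * x).trace)
    ?_ ?_ hx
  · intro c hc d hd
    have hcard : (Fintype.card n : ℂ) ≠ 0 := by exact_mod_cast Fintype.card_ne_zero
    have hre : ∀ a, ι a * b * (ι c * d) = ι (a * c) * (b * d) := fun a => by
      rw [map_mul, mul_assoc, ← mul_assoc b, ← h.commute c b hb]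
      simp only [mul_assoc]
    apply mul_left_cancel₀ hcard
    rw [hre, hre, h.card_mul_trace _ (mul_mem hb hd), h.card_mul_trace _ (mul_mem hb hd),
      trace_condExp_mul A a hc]
  · intro x y hx hy
    rw [mul_add, mul_add, Matrix.trace_add, Matrix.trace_add, hx, hy]

theorem IsTensorPair.condExp_condExp_amp [Nonempty n] (h : IsTensorPair ι N) {A B C : Alg n}
    (hABC : ∀ a, condExp A (condExp B a) = condExp C a) (x : Matrix κ κ ℂ) :
    condExp (amp ι N A) (condExp (amp ι N B) x) = condExp (amp ι N C) x := by
  have hle : ∀ A : Alg n, amp ι N A ≤ amp ι N ⊤ := fun A => amp_mono le_top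
  -- Both sides factor through the expectation onto `ι(M_n) N`, so only sums of products `ι a * b`
  -- need be treated.
  rw [← condExp_condExp_of_le (hle B), ← condExp_condExp_of_le (hle C)]
  refine h.amp_induction (A := ⊤) (p := fun x => condExp (amp ι N A) (condExp (amp ι N B) x) =
    condExp (amp ι N C) x) ?_ ?_ (condExp_mem _ x)
  · intro a _ b hb
    rw [h.condExp_amp B a hb, h.condExp_amp A _ hb, h.condExp_amp C a hb, hABC]
  · intro x y hx hy
    simp only [condExp_add, hx, hy]

/-- An element of both algebras is fixed by both expectations, hence by their composition, which is
the expectation onto `ι(S ∩ T) N`. -/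
theorem IsTensorPair.amp_inf [Nonempty n] (h : IsTensorPair ι N) {S T : Alg n}
    (hST : IsCommutingSquare S T) : amp ι N S ⊓ amp ι N T = amp ι N (S ⊓ T) := by
  refine le_antisymm (fun x hx => ?_) (le_inf (amp_mono inf_le_left) (amp_mono inf_le_right))
  have := h.condExp_condExp_amp (fun a => (hST a).1) x
  rw [condExp_of_mem hx.2, condExp_of_mem hx.1] at this
  exact this ▸ condExp_mem _ x

theorem amp_bot : amp ι N ⊥ = N := by
  refine sup_eq_right.2 ?_
  rintro _ ⟨_, ⟨c, rfl⟩, rfl⟩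
  exact (AlgHomClass.commutes ι c).symm ▸ N.algebraMap_mem c

theorem IsTensorPair.isCommutingSquare_amp [Nonempty n] (h : IsTensorPair ι N) {S T : Alg n}
    (hST : IsCommutingSquare S T) : IsCommutingSquare (amp ι N S) (amp ι N T) := fun x => by
  rw [h.amp_inf hST]
  exact ⟨h.condExp_condExp_amp (fun a => (hST a).1) x, h.condExp_condExp_amp (fun a => (hST a).2) x⟩

theorem IsTensorPair.amp_inf_commutant [Nonempty κ] (h : IsTensorPair ι N) (A : Alg n) :
    amp ι N A ⊓ commutant N = A.map ι := by
  obtain ⟨k, _, e, he, hmul, hone, hspan⟩ := h.factor.exists_matrixUnits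
  refine le_antisymm ?_ ?_
  · rintro x ⟨hx, hxc⟩
    have hxc := mem_commutant_iff.1 hxc
    -- The slice map `P` fixes the commutant of `N`, and sends `ι(a) b` to a multiple of `ι(a)`,
    -- because `P b` is central in `N`.
    let P : Matrix κ κ ℂ → Matrix κ κ ℂ := fun y => ∑ r, e r 0 * y * e 0 r
    have hP : P x = x := by
      have : ∀ r, e r 0 * x * e 0 r = x * e r r := fun r => by
        rw [hxc _ (he r 0), mul_assoc, hmul, if_pos rfl]
      simp only [P, this, ← Finset.mul_sum, hone, mul_one]
    rw [← hP]
    refine h.amp_induction (p := fun y => P y ∈ A.map ι) ?_ ?_ hx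
    · intro a ha b hb
      have h1 : P (ι a * b) = ι a * P b := by
        simp only [P, Finset.mul_sum]
        refine Finset.sum_congr rfl fun r _ => ?_
        rw [← mul_assoc, ← h.commute a _ (he r 0)]
        simp only [mul_assoc]
      obtain ⟨c, hc⟩ := h.factor.exists_eq_smul
        (sum_mem fun r _ => mul_mem (mul_mem (he r 0) hb) (he 0 r) : P b ∈ N)
        (matrixUnits_slice_comm hmul hspan b 0 0)
      rw [h1, show P b = c • 1 from hc, mul_smul_comm, mul_one]
      exact StarSubalgebra.smul_mem _ (⟨a, ha, rfl⟩ : ι a ∈ A.map ι) c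
    · intro y z hy hz
      have : P (y + z) = P y + P z := by
        simp only [P, mul_add, add_mul, Finset.sum_add_distrib]
      rw [this]
      exact add_mem hy hz
  · refine le_inf le_sup_left ?_
    rintro _ ⟨a, _, rfl⟩
    exact mem_commutant_iff.2 fun b hb => (h.commute a b hb).symm

end Amplification

/-! ### Classification of extensions and comparison of `I_sq` and `I_conv` -/

section Extension

variable {n κ : Type} [Fintype n] [DecidableEq n] [Fintype κ] [DecidableEq κ]

/-- An extension of the density `ρ` to `ι(M_n) N`, where `N` is a factor that commutes with the
range of `ι`. -/
structure IsTensorExtension (ρ : Matrix n n ℂ) (ι : Matrix n n ℂ →⋆ₐ[ℂ] Matrix κ κ ℂ) (N : Alg κ)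
    (ρ' : Matrix κ κ ℂ) : Prop extends IsTensorPair ι N where
  density : IsDensity ρ'
  mem : ρ' ∈ amp ι N ⊤
  expectation : ∀ a, (ρ' * ι a).trace = (ρ * a).trace

theorem party_eq_left {S T : Alg n} (h : S ⊓ T = ⊥) : party S T = S := by
  refine inf_eq_left.2 fun x _ => mem_commutant_iff.2 fun a ha => ?_
  rw [h] at ha
  obtain ⟨c, rfl⟩ := mem_bot_iff_exists_smul.1 ha
  rw [smul_mul_assoc, mul_smul_comm, one_mul, mul_one]

theorem party_eq_right {S T : Alg n} (h : S ⊓ T = ⊥) : party T S = T :=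
  party_eq_left (inf_comm S T ▸ h)

theorem map_comap_joint {S T A : Alg n} (hA : A ≤ joint S T)
    (ι : Matrix n n ℂ →⋆ₐ[ℂ] Matrix κ κ ℂ) :
    (A.comap (joint S T).subtype).map (ι.comp (joint S T).subtype) = A.map ι := by
  ext x
  constructor
  · rintro ⟨y, hy, rfl⟩
    exact ⟨_, hy, rfl⟩
  · rintro ⟨y, hy, rfl⟩
    exact ⟨⟨y, hA hy⟩, hy, rfl⟩

theorem IsTensorPair.party_amp [Nonempty n] [Nonempty κ] {ι : Matrix n n ℂ →⋆ₐ[ℂ] Matrix κ κ ℂ}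
    {N : Alg κ} (h : IsTensorPair ι N) {S T : Alg n} (hc : IsCommutingSquare S T)
    (hi : S ⊓ T = ⊥) : party (amp ι N S) (amp ι N T) = S.map ι := by
  rw [party, h.amp_inf hc, hi, amp_bot, h.amp_inf_commutant]

theorem IsCommutingSquare.symm {S T : Alg n} (h : IsCommutingSquare S T) : IsCommutingSquare T S :=
  fun a => inf_comm S T ▸ (h a).symm

theorem IsDensity.nonempty {ρ : Matrix n n ℂ} (h : IsDensity ρ) : Nonempty n := by
  by_contra hn
  rw [not_nonempty_iff] at hn
  simpa [Matrix.trace] using h.2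

/-- The intersection of `ι(S) N` and `ι(T) N` is `N`, and the relative commutants of `N` in them are
`ι(S)` and `ι(T)`, which are thus the algebras of the parties. -/
theorem IsTensorExtension.isExtension [Nonempty n] {m : ℕ} {ρ : Matrix n n ℂ}
    {ι : Matrix n n ℂ →⋆ₐ[ℂ] Matrix (Fin m) (Fin m) ℂ} {N : Alg (Fin m)}
    {ρ' : Matrix (Fin m) (Fin m) ℂ} (h : IsTensorExtension ρ ι N ρ') {S T : Alg n}
    (hc : IsCommutingSquare S T) (hi : S ⊓ T = ⊥) (hs : S ⊔ T = ⊤) :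
    IsExtension S T ρ (ι.comp (joint S T).subtype) (amp ι N S) (amp ι N T) ρ' := by
  have := h.density.nonempty
  have hS := party_eq_left hi
  have hT := party_eq_right hi
  exact
    { injective := h.injective.comp Subtype.val_injective
      square := h.isCommutingSquare_amp hc
      density := h.density
      mem := by rw [amp_sup, hs]; exact h.mem
      party_left := by
        rw [h.party_amp hc hi, map_comap_joint le_sup_left, hS]
      party_right := by
        rw [h.party_amp hc.symm (inf_comm S T ▸ hi), map_comap_joint le_sup_right, hT]
      expectation := fun a => h.expectation a }

theorem exists_eq_comp_subtype {B : Alg n} (hB : ∀ a, a ∈ B) (ι : B →⋆ₐ[ℂ] Matrix κ κ ℂ) :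
    ∃ ι₀ : Matrix n n ℂ →⋆ₐ[ℂ] Matrix κ κ ℂ, ι = ι₀.comp B.subtype :=
  ⟨ι.comp ((StarAlgHom.id ℂ _).codRestrict B hB), StarAlgHom.ext fun _ => rfl⟩

/-- The factor is `N = S' ∩ T'`, and the parties hold the relative commutants of `N` in `S'` and
`T'`. Each of `S', T'` is generated by `N` and its relative commutant. -/
theorem IsExtension.exists_isTensorExtension {m : ℕ} {ρ : Matrix n n ℂ} {S T : Alg n}
    {ι : joint S T →⋆ₐ[ℂ] Matrix (Fin m) (Fin m) ℂ} {S' T' : Alg (Fin m)}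
    {ρ' : Matrix (Fin m) (Fin m) ℂ} (h : IsExtension S T ρ ι S' T' ρ')
    (hi : S ⊓ T = ⊥) (hs : S ⊔ T = ⊤) :
    ∃ (ι₀ : Matrix n n ℂ →⋆ₐ[ℂ] Matrix (Fin m) (Fin m) ℂ) (N : Alg (Fin m)),
      IsTensorExtension ρ ι₀ N ρ' ∧ S' = amp ι₀ N S ∧ T' = amp ι₀ N T := by
  have hS := party_eq_left hi
  have hT := party_eq_right hi
  have hJ : joint S T = ⊤ := by rw [joint, hS, hT, hs]
  have hJ' : ∀ a, a ∈ joint S T := fun a => by rw [hJ]; exact StarSubalgebra.mem_top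
  have := h.density.nonempty
  obtain ⟨ι₀, rfl⟩ := exists_eq_comp_subtype hJ' ι
  have hinj : Function.Injective ι₀ := by
    intro a b hab
    have h1 : (⟨a, hJ' a⟩ : joint S T) = ⟨b, hJ' b⟩ := h.injective (by
      rw [StarAlgHom.comp_apply, StarAlgHom.comp_apply]
      exact hab)
    exact (Subtype.mk.injEq _ _ _ _).mp h1
  have hl : S.map ι₀ = party S' T' := by
    rw [← h.party_left, map_comap_joint le_sup_left, hS]
  have hr : T.map ι₀ = party T' S' := by
    rw [← h.party_right, map_comap_joint le_sup_right, hT]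
  have hN : party S' T' = S' ⊓ commutant (S' ⊓ T') := rfl
  have hN' : party T' S' = T' ⊓ commutant (S' ⊓ T') := by rw [party, inf_comm T' S']
  -- A central element of `S' ∩ T'` belongs to both parties, hence to `ι(S ∩ T) = ℂ1`.
  have hfac : IsFactor (S' ⊓ T') := by
    refine le_bot_iff.1 ?_
    rintro z ⟨hz, hzc⟩
    have h1 : z ∈ S.map ι₀ := by rw [hl, hN]; exact ⟨hz.1, hzc⟩
    have h2 : z ∈ T.map ι₀ := by rw [hr, hN']; exact ⟨hz.2, hzc⟩
    have h3 : z ∈ (S ⊓ T).map ι₀ := by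
      rw [StarSubalgebra.map_inf ι₀ hinj]; exact ⟨h1, h2⟩
    rw [hi] at h3
    obtain ⟨_, ⟨c, rfl⟩, rfl⟩ := h3
    refine mem_bot_iff_exists_smul.2 ⟨c, ?_⟩
    change ι₀ (algebraMap ℂ _ c) = _
    rw [AlgHomClass.commutes, Algebra.algebraMap_eq_smul_one]
  have hS' : S' = amp ι₀ (S' ⊓ T') S := by
    rw [amp, hl, hN]; exact hfac.eq_commutant_sup inf_le_left
  have hT' : T' = amp ι₀ (S' ⊓ T') T := by
    rw [amp, hr, hN']; exact hfac.eq_commutant_sup inf_le_right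
  refine ⟨ι₀, S' ⊓ T', ⟨⟨hinj, fun a b hb => ?_, hfac⟩, h.density, ?_, fun a => ?_⟩, hS', hT'⟩
  · have h1 : (⊤ : Alg n).map ι₀ ≤ commutant (S' ⊓ T') := by
      rw [← hs, StarSubalgebra.map_sup, hl, hr, hN, hN']
      exact sup_le inf_le_right inf_le_right
    exact (mem_commutant_iff.1 (h1 ⟨a, StarSubalgebra.mem_top, rfl⟩) b hb).symm
  · rw [← hs, ← amp_sup, ← hS', ← hT']; exact h.mem
  · have := h.expectation ⟨a, hJ' a⟩
    rwa [StarAlgHom.comp_apply, StarSubalgebra.subtype_apply] at this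

theorem IsFactor.map {N : Alg n} (hN : IsFactor N) {φ : Matrix n n ℂ →⋆ₐ[ℂ] Matrix κ κ ℂ}
    (hφ : Function.Injective φ) : IsFactor (N.map φ) := by
  refine le_bot_iff.1 ?_
  rintro _ ⟨⟨a, ha, rfl⟩, hc⟩
  have hc := mem_commutant_iff.1 hc
  obtain ⟨c, rfl⟩ := hN.exists_eq_smul ha fun b hb => hφ (by
    simpa using hc _ ⟨b, hb, rfl⟩)
  exact mem_bot_iff_exists_smul.2 ⟨c, by change φ _ = _; rw [map_smul, map_one]⟩

theorem map_amp {μ : Type} [Fintype μ] [DecidableEq μ] (φ : Matrix κ κ ℂ →⋆ₐ[ℂ] Matrix μ μ ℂ)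
    (ι : Matrix n n ℂ →⋆ₐ[ℂ] Matrix κ κ ℂ) (N : Alg κ) (A : Alg n) :
    (amp ι N A).map φ = amp (φ.comp ι) (N.map φ) A := by
  rw [amp, StarSubalgebra.map_sup, StarSubalgebra.map_map]

theorem IsTensorExtension.map {μ : Type} [Fintype μ] [DecidableEq μ] {ρ : Matrix n n ℂ}
    {ι : Matrix n n ℂ →⋆ₐ[ℂ] Matrix κ κ ℂ} {N : Alg κ} {ρ' : Matrix κ κ ℂ}
    (h : IsTensorExtension ρ ι N ρ') {φ : Matrix κ κ ℂ →⋆ₐ[ℂ] Matrix μ μ ℂ} (hφ : IsTraceIso φ) :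
    IsTensorExtension ρ (φ.comp ι) (N.map φ) (φ ρ') where
  injective := hφ.injective.comp h.injective
  commute a b hb := by
    obtain ⟨b, hb, rfl⟩ := hb
    change φ (ι a) * φ b = φ b * φ (ι a)
    rw [← map_mul, h.commute a b hb, map_mul]
  factor := h.factor.map hφ.injective
  density := hφ.isDensity_map h.density
  mem := map_amp φ ι N ⊤ ▸ ⟨ρ', h.mem, rfl⟩
  expectation a := by
    rw [StarAlgHom.comp_apply, ← map_mul, hφ.trace, h.expectation]

/-- Renaming of the basis, as a `*`-homomorphism of matrix algebras. -/
def reindexHom {μ : Type} [Fintype μ] [DecidableEq μ] (e : κ ≃ μ) :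
    Matrix κ κ ℂ →⋆ₐ[ℂ] Matrix μ μ ℂ :=
  { (Matrix.reindexAlgEquiv ℂ ℂ e).toAlgHom with
    map_star' := fun _ => rfl }

theorem isTraceIso_reindexHom {μ : Type} [Fintype μ] [DecidableEq μ] (e : κ ≃ μ) :
    IsTraceIso (reindexHom e) where
  surjective := (Matrix.reindexAlgEquiv ℂ ℂ e).surjective
  trace a := by
    change ∑ i, a (e.symm i) (e.symm i) = ∑ i, a i i
    exact Equiv.sum_comp e.symm fun i => a i i

/-- Renaming the basis by `Fin m` allows extensions on any finite index type, such as the products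
with a register used later. -/
theorem Isq_le_mutualInfo [Nonempty n] {ρ : Matrix n n ℂ}
    {ι : Matrix n n ℂ →⋆ₐ[ℂ] Matrix κ κ ℂ} {N : Alg κ} {ρ' : Matrix κ κ ℂ}
    (h : IsTensorExtension ρ ι N ρ') {S T : Alg n}
    (hc : IsCommutingSquare S T) (hi : S ⊓ T = ⊥) (hs : S ⊔ T = ⊤) :
    Isq S T ρ ≤ ((1 / 2 * mutualInfo (amp ι N S) (amp ι N T) ρ' : ℝ) : EReal) := by
  have hφ := isTraceIso_reindexHom (Fintype.equivFin κ)
  have h1 := (h.map hφ).isExtension hc hi hs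
  refine sInf_le ⟨_, _, _, _, _, h1, ?_⟩
  rw [← map_amp, ← map_amp, hφ.mutualInfo_map _ _ h.density.isSelfAdjoint]

/-- Squashed mutual informations are compared extension by extension. -/
theorem Isq_le_Isq {n' : Type} [Fintype n'] [DecidableEq n'] [Nonempty n']
    {S T : Alg n} {S₁ T₁ : Alg n'} {ρ : Matrix n n ℂ} {ρ₁ : Matrix n' n' ℂ}
    (hi : S ⊓ T = ⊥) (hs : S ⊔ T = ⊤)
    (hc₁ : IsCommutingSquare S₁ T₁) (hi₁ : S₁ ⊓ T₁ = ⊥) (hs₁ : S₁ ⊔ T₁ = ⊤)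
    (h : ∀ (m : ℕ) (ι : Matrix n n ℂ →⋆ₐ[ℂ] Matrix (Fin m) (Fin m) ℂ) (N : Alg (Fin m))
      (ρ' : Matrix (Fin m) (Fin m) ℂ), IsTensorExtension ρ ι N ρ' →
      ∃ (μ : Type) (_ : Fintype μ) (_ : DecidableEq μ) (ι₁ : Matrix n' n' ℂ →⋆ₐ[ℂ] Matrix μ μ ℂ)
        (N₁ : Alg μ) (ρ₁' : Matrix μ μ ℂ), IsTensorExtension ρ₁ ι₁ N₁ ρ₁' ∧
        mutualInfo (amp ι₁ N₁ S₁) (amp ι₁ N₁ T₁) ρ₁' ≤ mutualInfo (amp ι N S) (amp ι N T) ρ') :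
    Isq S₁ T₁ ρ₁ ≤ Isq S T ρ := by
  refine le_sInf ?_
  rintro _ ⟨m, ι, S', T', ρ', hE, rfl⟩
  obtain ⟨ι₀, N, h0, rfl, rfl⟩ := hE.exists_isTensorExtension hi hs
  obtain ⟨μ, _, _, ι₁, N₁, ρ₁', h1, hle⟩ := h m ι₀ N ρ' h0
  refine (Isq_le_mutualInfo h1 hc₁ hi₁ hs₁).trans ?_
  exact EReal.coe_le_coe_iff.2 (by linarith)

/-- Every extension of a pure state is a product. -/
theorem IsTensorExtension.eq_mul_condExp [Nonempty n] {v : n → ℂ} (hv : star v ⬝ᵥ v = 1)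
    {ι : Matrix n n ℂ →⋆ₐ[ℂ] Matrix κ κ ℂ} {N : Alg κ} {ρ' : Matrix κ κ ℂ}
    (h : IsTensorExtension (ketbra v) ι N ρ') :
    ρ' = ι (ketbra v) * ((Fintype.card n : ℂ) • condExp N ρ') := by
  have hp := isStarProjection_ketbra hv
  have hp' : IsStarProjection (ι (ketbra v)) :=
    ⟨by rw [IsIdempotentElem, ← map_mul, hp.isIdempotentElem.eq], hp.isSelfAdjoint.map ι⟩
  -- The projection `ι(|v⟩⟨v|)` has expectation one in `ρ'`, so it supports `ρ'`.
  obtain ⟨h1, h2⟩ := h.density.mul_projection hp' (by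
    rw [h.expectation, hp.isIdempotentElem.eq, (isDensity_ketbra hv).2])
  have hD : (Fintype.card n : ℂ) • condExp N ρ' ∈ N := N.smul_mem (condExp_mem N ρ') _
  -- Since `ρ'` lies in `ι(M_n) N`, it is determined by its traces against that algebra. The factor
  -- `card n` in the claim compensates for the one in `card_mul_trace`.
  rw [← condExp_of_mem h.mem]
  nth_rewrite 2 [condExp_of_mem h.mem]
  refine condExp_eq (mul_mem_amp StarSubalgebra.mem_top hD) fun x hx => ?_
  refine h.amp_induction (A := ⊤)
    (p := fun x => (ι (ketbra v) * ((Fintype.card n : ℂ) • condExp N ρ') * x).trace =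
      (ρ' * x).trace) ?_ ?_ hx
  · intro a _ b hb
    -- Compression by the rank-one projection replaces `a` by its expectation in the pure state.
    have h3 : (ρ' * (ι a * b)).trace = (ketbra v * a).trace * (ρ' * b).trace := by
      have h4 : ι (ketbra v) * (ι a * b) * ι (ketbra v) =
          (ketbra v * a).trace • (ι (ketbra v) * b) := by
        rw [← smul_mul_assoc, ← map_smul, ← ketbra_mul_mul_ketbra, map_mul, map_mul]
        simp only [mul_assoc, ← h.commute _ b hb]
      have h5 : (ρ' * (ι a * b)).trace = (ρ' * (ι (ketbra v) * (ι a * b) * ι (ketbra v))).trace := by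
        rw [← mul_assoc ρ' _ (ι (ketbra v)), Matrix.trace_mul_comm _ (ι (ketbra v)),
          ← mul_assoc (ι (ketbra v)) ρ', h2, ← mul_assoc ρ' (ι (ketbra v)), h1]
      rw [h5, h4, mul_smul_comm, Matrix.trace_smul, ← mul_assoc, h1, smul_eq_mul]
    rw [h3, mul_assoc, smul_mul_assoc, mul_smul_comm, Matrix.trace_smul, ← mul_assoc (condExp N ρ'),
      ← h.commute a _ (condExp_mem N ρ'), mul_assoc, ← mul_assoc, ← map_mul, smul_eq_mul,
      h.card_mul_trace _ (mul_mem (condExp_mem N ρ') hb), trace_condExp_mul N ρ' hb]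
  · intro x y hx hy
    rw [mul_add, mul_add, Matrix.trace_add, Matrix.trace_add, hx, hy]

/-- In a pure state, the squashed mutual information only depends on the state through its
expectations. -/
theorem Isq_le_Isq_of_pure [Nonempty n] {v : n → ℂ} (hv : star v ⬝ᵥ v = 1) {S T S₁ T₁ : Alg n}
    (hc : IsCommutingSquare S T) (hi : S ⊓ T = ⊥) (hs : S ⊔ T = ⊤)
    (hc₁ : IsCommutingSquare S₁ T₁) (hi₁ : S₁ ⊓ T₁ = ⊥) (hs₁ : S₁ ⊔ T₁ = ⊤)
    (hS : condExp S₁ (ketbra v) = condExp S (ketbra v))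
    (hT : condExp T₁ (ketbra v) = condExp T (ketbra v)) :
    Isq S₁ T₁ (ketbra v) ≤ Isq S T (ketbra v) := by
  refine Isq_le_Isq hi hs hc₁ hi₁ hs₁ fun m ι N ρ' h => ⟨Fin m, _, _, ι, N, ρ', h, le_of_eq ?_⟩
  have hD : (Fintype.card n : ℂ) • condExp N ρ' ∈ N := N.smul_mem (condExp_mem N ρ') _
  -- On the product state `ι(ρ) D` the expectation onto `ι(A) N` gives `ι(E_A(ρ)) D`.
  have key : ∀ A B : Alg n, condExp A (ketbra v) = condExp B (ketbra v) →
      algEntropy (amp ι N A) ρ' = algEntropy (amp ι N B) ρ' := fun A B hAB => by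
    rw [h.eq_mul_condExp hv, algEntropy, algEntropy, h.condExp_amp _ _ hD, h.condExp_amp _ _ hD, hAB]
  rw [mutualInfo, mutualInfo, h.amp_inf hc, h.amp_inf hc₁, amp_sup, amp_sup, hi, hi₁, hs, hs₁,
    key _ _ hS, key _ _ hT]

theorem mutualInfo_eq_of_condExp_eq {ρ : Matrix n n ℂ} {S T S₁ T₁ : Alg n}
    (hi : S ⊓ T = ⊥) (hs : S ⊔ T = ⊤) (hi₁ : S₁ ⊓ T₁ = ⊥) (hs₁ : S₁ ⊔ T₁ = ⊤)
    (hS : condExp S₁ ρ = condExp S ρ) (hT : condExp T₁ ρ = condExp T ρ) :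
    mutualInfo S₁ T₁ ρ = mutualInfo S T ρ := by
  rw [mutualInfo, mutualInfo, hi, hi₁, hs, hs₁, algEntropy, algEntropy, hS, hT]
  rfl

/-- By extremality every member of an ensemble with nonzero weight is the pure state itself. -/
theorem Iconv_le_Iconv_of_pure {v : n → ℂ} (hv : star v ⬝ᵥ v = 1) {S T S₁ T₁ : Alg n}
    (h : mutualInfo S₁ T₁ (ketbra v) = mutualInfo S T (ketbra v)) :
    Iconv S₁ T₁ (ketbra v) ≤ Iconv S T (ketbra v) := by
  refine sInf_le_sInf ?_
  rintro _ ⟨k, p, σ, hp, hp1, hσ, hsum, rfl⟩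
  refine ⟨k, p, σ, hp, hp1, hσ, hsum, ?_⟩
  refine congrArg (fun t : ℝ => ((1 / 2 * t : ℝ) : EReal)) (Finset.sum_congr rfl fun i _ => ?_)
  rcases eq_or_ne (p i) 0 with h0 | h0
  · rw [h0, zero_mul, zero_mul]
  · rw [eq_ketbra_of_sum_eq hv hp hσ hsum h0, h]

theorem isCommutingSquare_map_conj {S T : Alg n} (hc : IsCommutingSquare S T)
    (U : unitary (Matrix n n ℂ)) : IsCommutingSquare (S.map (conj U)) (T.map (conj U)) := by
  have hφ := isTraceIso_conj U
  intro a
  obtain ⟨b, rfl⟩ := hφ.surjective a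
  rw [← StarSubalgebra.map_inf _ hφ.injective]
  simp only [hφ.condExp_map, (hc b).1, (hc b).2, and_self]

theorem map_conj_inf_eq_bot {S T : Alg n} (hi : S ⊓ T = ⊥) (U : unitary (Matrix n n ℂ)) :
    S.map (conj U) ⊓ T.map (conj U) = ⊥ := by
  rw [← StarSubalgebra.map_inf _ (isTraceIso_conj U).injective, hi]
  refine le_bot_iff.1 ?_
  rintro _ ⟨_, ⟨c, rfl⟩, rfl⟩
  exact ⟨c, (AlgHomClass.commutes (conj U) c).symm⟩

theorem map_conj_sup_eq_top {S T : Alg n} (hs : S ⊔ T = ⊤) (U : unitary (Matrix n n ℂ)) :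
    S.map (conj U) ⊔ T.map (conj U) = ⊤ := by
  rw [← StarSubalgebra.map_sup, hs]
  exact StarSubalgebra.eq_top_iff.2 fun a => ⟨_, StarSubalgebra.mem_top, conj_conj_star U a⟩

/-- The extension itself stays unchanged; only its embedding is precomposed with the conjugation by
`U†`. -/
theorem Isq_conj_le [Nonempty n] {S T : Alg n} (hc : IsCommutingSquare S T) (hi : S ⊓ T = ⊥)
    (hs : S ⊔ T = ⊤) (U : unitary (Matrix n n ℂ)) (ρ : Matrix n n ℂ) :
    Isq (S.map (conj U)) (T.map (conj U)) (conj U ρ) ≤ Isq S T ρ := by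
  refine Isq_le_Isq hi hs (isCommutingSquare_map_conj hc U) (map_conj_inf_eq_bot hi U)
    (map_conj_sup_eq_top hs U) fun m ι N ρ' h =>
      ⟨Fin m, _, _, ι.comp (conj (star U)), N, ρ', ?_, le_of_eq ?_⟩
  · have hinj := (isTraceIso_conj (star U)).injective
    refine ⟨⟨h.injective.comp hinj, fun a b hb => h.commute _ b hb, h.factor⟩, h.density, ?_,
      fun a => ?_⟩
    · have : (⊤ : Alg n).map (conj (star U)) = ⊤ :=
        StarSubalgebra.eq_top_iff.2 fun a => ⟨_, StarSubalgebra.mem_top, conj_star_conj U a⟩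
      rw [amp, ← StarSubalgebra.map_map, this]
      exact h.mem
    · rw [StarAlgHom.comp_apply, h.expectation, ← (isTraceIso_conj U).trace, map_mul, conj_conj_star]
  · have : ∀ A : Alg n, amp (ι.comp (conj (star U))) N (A.map (conj U)) = amp ι N A := fun A => by
      rw [amp, ← StarSubalgebra.map_map, map_conj_star_eq rfl]
    rw [this, this]

theorem Iconv_conj_le {S T : Alg n} (U : unitary (Matrix n n ℂ)) (ρ : Matrix n n ℂ) :
    Iconv (S.map (conj U)) (T.map (conj U)) (conj U ρ) ≤ Iconv S T ρ := by
  have hφ := isTraceIso_conj U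
  refine sInf_le_sInf ?_
  rintro _ ⟨k, p, σ, hp, hp1, hσ, hsum, rfl⟩
  refine ⟨k, p, fun i => conj U (σ i), hp, hp1, fun i => hφ.isDensity_map (hσ i), ?_, ?_⟩
  · rw [← hsum, map_sum]
    simp only [map_smul]
  · simp only [hφ.mutualInfo_map S T (hσ _).isSelfAdjoint]

theorem Isq_conj [Nonempty n] {S T S₁ T₁ : Alg n} (hc : IsCommutingSquare S T) (hi : S ⊓ T = ⊥)
    (hs : S ⊔ T = ⊤) {U : unitary (Matrix n n ℂ)} (hS : S.map (conj U) = S₁)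
    (hT : T.map (conj U) = T₁) (ρ : Matrix n n ℂ) : Isq S₁ T₁ (conj U ρ) = Isq S T ρ := by
  subst hS hT
  refine le_antisymm (Isq_conj_le hc hi hs U ρ) ?_
  have := Isq_conj_le (isCommutingSquare_map_conj hc U) (map_conj_inf_eq_bot hi U)
    (map_conj_sup_eq_top hs U) (star U) (conj U ρ)
  rwa [map_conj_star_eq rfl, map_conj_star_eq rfl, conj_star_conj] at this

theorem Iconv_conj {S T S₁ T₁ : Alg n} {U : unitary (Matrix n n ℂ)} (hS : S.map (conj U) = S₁)
    (hT : T.map (conj U) = T₁) (ρ : Matrix n n ℂ) : Iconv S₁ T₁ (conj U ρ) = Iconv S T ρ := by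
  subst hS hT
  refine le_antisymm (Iconv_conj_le U ρ) ?_
  have := Iconv_conj_le (S := S.map (conj U)) (T := T.map (conj U)) (star U) (conj U ρ)
  rwa [map_conj_star_eq rfl, map_conj_star_eq rfl, conj_star_conj] at this

end Extension

/-! ### Averaging and the convex roof -/

section Average

variable {n : Type} [Fintype n] [DecidableEq n]

/-- An ensemble `(p_j, σ_j)` of `ρ` yields the ensemble `(w_i p_j, U_i σ_j U_i†)` of the average.
Its mean information is the same, because the unitaries normalize `S` and `T`. -/
theorem Iconv_average_le {S T : Alg n} {k : ℕ} (w : Fin k → ℝ) (hw : ∀ i, 0 ≤ w i)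
    (hw1 : ∑ i, w i = 1) (U : Fin k → unitary (Matrix n n ℂ))
    (hS : ∀ i, S.map (conj (U i)) = S) (hT : ∀ i, T.map (conj (U i)) = T) (ρ : Matrix n n ℂ) :
    Iconv S T (∑ i, (w i : ℂ) • conj (U i) ρ) ≤ Iconv S T ρ := by
  refine sInf_le_sInf ?_
  rintro _ ⟨l, p, σ, hp, hp1, hσ, hsum, rfl⟩
  let e := (finProdFinEquiv (m := k) (n := l)).symm
  refine ⟨k * l, fun x => w (e x).1 * p (e x).2, fun x => conj (U (e x).1) (σ (e x).2),
    fun x => mul_nonneg (hw _) (hp _), ?_, fun x => (isTraceIso_conj _).isDensity_map (hσ _), ?_, ?_⟩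
  · rw [e.sum_comp fun x => w x.1 * p x.2, Fintype.sum_prod_type]
    simp only [← Finset.mul_sum, hp1, mul_one, hw1]
  · rw [e.sum_comp fun x => ((w x.1 * p x.2 : ℝ) : ℂ) • conj (U x.1) (σ x.2),
      Fintype.sum_prod_type]
    refine Finset.sum_congr rfl fun i _ => ?_
    rw [← hsum, map_sum, Finset.smul_sum]
    refine Finset.sum_congr rfl fun j _ => ?_
    rw [map_smul, smul_smul, Complex.ofReal_mul]
  · rw [e.sum_comp fun x => (w x.1 * p x.2) * mutualInfo S T (conj (U x.1) (σ x.2)),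
      Fintype.sum_prod_type]
    simp only [mutualInfo_conj (hS _) (hT _) (hσ _).isSelfAdjoint, mul_assoc, ← Finset.mul_sum]
    rw [← Finset.sum_mul, hw1, one_mul]

end Average

/-! ### Adjoining a register, and averaging for `I_sq` -/

section Block

variable {κ o : Type} [Fintype κ] [DecidableEq κ] [Fintype o] [DecidableEq o]

/-- The block at position `(i, j)`. -/
def blk (x : Matrix (κ × o) (κ × o) ℂ) (i j : o) : Matrix κ κ ℂ := x.submatrix (·, i) (·, j)

theorem blk_ext {x y : Matrix (κ × o) (κ × o) ℂ} (h : ∀ i j, blk x i j = blk y i j) : x = y := by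
  ext ⟨a, i⟩ ⟨b, j⟩
  exact congrFun (congrFun (h i j) a) b

theorem blk_mul (x y : Matrix (κ × o) (κ × o) ℂ) (i j : o) :
    blk (x * y) i j = ∑ l, blk x i l * blk y l j := by
  ext a b
  simp only [blk, Matrix.submatrix_apply, Matrix.mul_apply, Matrix.sum_apply, Fintype.sum_prod_type]
  exact Finset.sum_comm

theorem blk_blockDiagonal (d : o → Matrix κ κ ℂ) (i j : o) :
    blk (Matrix.blockDiagonal d) i j = if i = j then d i else 0 := by
  ext a b
  simp only [blk, Matrix.submatrix_apply, Matrix.blockDiagonal_apply]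
  split_ifs <;> rfl

theorem trace_eq_sum_blk (x : Matrix (κ × o) (κ × o) ℂ) : x.trace = ∑ i, (blk x i i).trace := by
  simp only [Matrix.trace, Matrix.diag, Fintype.sum_prod_type]
  exact Finset.sum_comm

theorem trace_blockDiagonal_mul (d : o → Matrix κ κ ℂ) (x : Matrix (κ × o) (κ × o) ℂ) :
    (Matrix.blockDiagonal d * x).trace = ∑ i, (d i * blk x i i).trace := by
  simp [trace_eq_sum_blk, blk_mul, blk_blockDiagonal]

/-- `a ↦ a ⊗ 1`. -/
def dup (o : Type) [Fintype o] [DecidableEq o] :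
    Matrix κ κ ℂ →⋆ₐ[ℂ] Matrix (κ × o) (κ × o) ℂ where
  toFun a := Matrix.blockDiagonal fun _ => a
  map_one' := Matrix.blockDiagonal_one
  map_mul' a b := Matrix.blockDiagonal_mul _ _
  map_zero' := Matrix.blockDiagonal_zero
  map_add' a b := Matrix.blockDiagonal_add _ _
  commutes' r := by
    simp only [Algebra.algebraMap_eq_smul_one]
    rw [← Matrix.blockDiagonal_one, ← Matrix.blockDiagonal_smul]
    rfl
  map_star' a := (Matrix.blockDiagonal_conjTranspose _).symm

theorem dup_apply (a : Matrix κ κ ℂ) : dup o a = Matrix.blockDiagonal fun _ => a := rfl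

/-- `N ⊗ M_o(ℂ)`. -/
def blockAlg (o : Type) [Fintype o] [DecidableEq o] (N : Alg κ) : Alg (κ × o) where
  carrier := {x | ∀ i j, blk x i j ∈ N}
  mul_mem' hx hy i j := by
    rw [blk_mul]
    exact sum_mem fun l _ => mul_mem (hx i l) (hy l j)
  add_mem' hx hy i j := add_mem (hx i j) (hy i j)
  algebraMap_mem' r i j := by
    rw [← AlgHomClass.commutes (dup o) r, dup_apply, blk_blockDiagonal]
    split_ifs
    · exact N.algebraMap_mem r
    · exact zero_mem N
  star_mem' hx i j := star_mem (hx j i)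

theorem blockDiagonal_mem_blockAlg {N : Alg κ} {d : o → Matrix κ κ ℂ} (hd : ∀ i, d i ∈ N) :
    Matrix.blockDiagonal d ∈ blockAlg o N := fun i j => by
  rw [blk_blockDiagonal]
  split_ifs
  · exact hd i
  · exact zero_mem N

theorem condExp_blockAlg (N : Alg κ) (d : o → Matrix κ κ ℂ) :
    condExp (blockAlg o N) (Matrix.blockDiagonal d) = Matrix.blockDiagonal fun i => condExp N (d i) :=
  condExp_eq (blockDiagonal_mem_blockAlg fun _ => condExp_mem _ _) fun b hb => by
    rw [trace_blockDiagonal_mul, trace_blockDiagonal_mul]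
    exact Finset.sum_congr rfl fun i _ => trace_condExp_mul N _ (hb i i)

/-- `1 ⊗ E_{ij}`. -/
def blkUnit (i j : o) : Matrix (κ × o) (κ × o) ℂ :=
  Matrix.of fun p q => if p.1 = q.1 ∧ p.2 = i ∧ q.2 = j then 1 else 0

theorem blk_blkUnit (i j r s : o) :
    blk (blkUnit i j : Matrix (κ × o) (κ × o) ℂ) r s = if r = i ∧ s = j then 1 else 0 := by
  ext a b
  by_cases hab : a = b <;> by_cases hr : r = i ∧ s = j <;>
    simp [blk, blkUnit, hab, hr, Matrix.one_apply]

theorem eq_sum_dup_mul_blkUnit (x : Matrix (κ × o) (κ × o) ℂ) :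
    x = ∑ i, ∑ j, dup o (blk x i j) * blkUnit i j := by
  ext ⟨a, r⟩ ⟨b, s⟩
  simp only [dup_apply, Matrix.sum_apply, Matrix.mul_apply, Matrix.blockDiagonal_apply, blk,
    Matrix.submatrix_apply, blkUnit, Matrix.of_apply, Fintype.sum_prod_type]
  simp [ite_and]

theorem blkUnit_mem (N : Alg κ) (i j : o) : blkUnit i j ∈ blockAlg o N := fun r s => by
  rw [blk_blkUnit]
  split_ifs
  · exact one_mem N
  · exact zero_mem N

variable {n : Type} [Fintype n] [DecidableEq n]

/-- The register can be placed in the factor: both sides are `ι(A) N ⊗ M_o`. -/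
theorem amp_dup (ι : Matrix n n ℂ →⋆ₐ[ℂ] Matrix κ κ ℂ) (N : Alg κ) (A : Alg n) :
    amp ((dup o).comp ι) (blockAlg o N) A = blockAlg o (amp ι N A) := by
  refine le_antisymm (sup_le ?_ ?_) fun x hx => ?_
  · rintro _ ⟨a, ha, rfl⟩
    exact blockDiagonal_mem_blockAlg fun _ => StarSubalgebra.mem_sup_left ⟨a, ha, rfl⟩
  · exact fun x hx i j => StarSubalgebra.mem_sup_right (hx i j)
  · have h1 : (amp ι N A).map (dup o) ≤ amp ((dup o).comp ι) (blockAlg o N) A := by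
      rw [map_amp]
      refine sup_le_sup_left ?_ _
      rintro _ ⟨b, hb, rfl⟩
      exact blockDiagonal_mem_blockAlg fun _ => hb
    rw [eq_sum_dup_mul_blkUnit x]
    exact sum_mem fun i _ => sum_mem fun j _ => mul_mem (h1 ⟨_, hx i j, rfl⟩)
      (StarSubalgebra.mem_sup_right (blkUnit_mem N i j))

theorem dup_injective [Nonempty o] : Function.Injective (dup o : Matrix κ κ ℂ → _) :=
  fun a b h => by
    obtain ⟨i⟩ := ‹Nonempty o›
    have := congrArg (fun x => blk x i i) h
    simpa [dup_apply, blk_blockDiagonal] using this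

/-- Commuting with all `1 ⊗ E_ij` forces the form `c ⊗ 1` with `c` central in `N`. This is why the
register algebra is all of `M_o`; a diagonal one would have a centre. -/
theorem IsFactor.blockAlg [Nonempty o] {N : Alg κ} (h : IsFactor N) :
    IsFactor (blockAlg o N) := by
  refine le_bot_iff.1 ?_
  rintro z ⟨hz, hzc⟩
  have hzc := mem_commutant_iff.1 hzc
  have hu : ∀ i j, blkUnit i j * z = z * blkUnit i j := fun i j => hzc _ (blkUnit_mem N i j)
  obtain ⟨i₀⟩ := ‹Nonempty o›
  have h1 : z = dup o (blk z i₀ i₀) := by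
    refine blk_ext fun i j => ?_
    have := congrArg (fun x => blk x i₀ j) (hu i₀ i)
    simp only [blk_mul, blk_blkUnit] at this
    rw [dup_apply, blk_blockDiagonal]
    simpa [ite_and, eq_comm] using this
  obtain ⟨c, hc⟩ := h.exists_eq_smul (hz i₀ i₀) fun b hb => by
    have := congrArg (fun x => blk x i₀ i₀)
      (hzc (dup o b) (blockDiagonal_mem_blockAlg fun _ => hb))
    simpa [blk_mul, dup_apply, blk_blockDiagonal] using this
  exact mem_bot_iff_exists_smul.2 ⟨c, by rw [h1, hc, map_smul, map_one]⟩

theorem IsTensorPair.dup [Nonempty o] {ι : Matrix n n ℂ →⋆ₐ[ℂ] Matrix κ κ ℂ} {N : Alg κ}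
    (h : IsTensorPair ι N) : IsTensorPair ((dup o).comp ι) (SubalgebraResource.blockAlg o N) where
  injective := dup_injective.comp h.injective
  commute a b hb := blk_ext fun i j => by
    simp only [StarAlgHom.comp_apply, dup_apply, blk_mul, blk_blockDiagonal]
    simp [h.commute a _ (hb i j)]
  factor := h.factor.blockAlg

theorem trace_dup (a : Matrix κ κ ℂ) : (dup o a).trace = Fintype.card o * a.trace := by
  simp [dup_apply, trace_eq_sum_blk, blk_blockDiagonal]

/-- With `η(x) = -x log x`, this is `η(c x) = c η(x) + η(c) x` on the spectrum. -/
theorem cfc_negMulLog_smul {a : Matrix κ κ ℂ} (ha : IsSelfAdjoint a) (c : ℝ) :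
    cfc Real.negMulLog (c • a) = c • cfc Real.negMulLog a + Real.negMulLog c • a := by
  have hcont : ∀ f : ℝ → ℝ, ContinuousOn f (spectrum ℝ a) := fun f =>
    (Matrix.finite_real_spectrum (A := a)).continuousOn f
  rw [← cfc_comp_const_mul c Real.negMulLog a (Real.continuous_negMulLog.continuousOn) ha,
    ← cfc_smul c Real.negMulLog a (hcont _)]
  conv_rhs => rw [← cfc_const_mul_id (Real.negMulLog c) a ha]
  rw [← cfc_add a _ _ (hcont _) (hcont _)]
  refine congrArg (fun f => cfc f a) (funext fun x => ?_)
  rw [Real.negMulLog_mul, smul_eq_mul]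
  ring

/-- The added constant is the entropy of a uniform register; what matters is that it does not depend
on `a`. -/
theorem vonNeumannEntropy_dup [Nonempty o] {a : Matrix κ κ ℂ} (ha : IsSelfAdjoint a)
    (htr : a.trace = 1) :
    vonNeumannEntropy (dup o ((Fintype.card o : ℝ)⁻¹ • a)) =
      vonNeumannEntropy a +
        Fintype.card o * Real.negMulLog (Fintype.card o : ℝ)⁻¹ / Real.log 2 := by
  have hc : (Fintype.card o : ℝ) ≠ 0 := by exact_mod_cast Fintype.card_ne_zero
  have hsa : IsSelfAdjoint ((Fintype.card o : ℝ)⁻¹ • a) := (IsSelfAdjoint.all _).smul ha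
  rw [vonNeumannEntropy, ← map_cfc_matrix _ _ hsa, cfc_negMulLog_smul ha, trace_dup,
    Matrix.trace_add, Matrix.trace_smul, Matrix.trace_smul, htr, vonNeumannEntropy, ← add_div]
  congr 1
  have h1 : ((Fintype.card o : ℕ) : ℂ) = ((Fintype.card o : ℝ) : ℂ) := by simp
  rw [h1, Complex.re_ofReal_mul, Complex.add_re, Complex.real_smul, Complex.re_ofReal_mul,
    Complex.real_smul, Complex.re_ofReal_mul, Complex.one_re]
  field_simp

/-- The block diagonal unitary with blocks `V i`. -/
def blockUnitary (V : o → unitary (Matrix κ κ ℂ)) : unitary (Matrix (κ × o) (κ × o) ℂ) :=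
  ⟨Matrix.blockDiagonal fun i => (V i : Matrix κ κ ℂ), by
    rw [Unitary.mem_iff, Matrix.star_eq_conjTranspose, Matrix.blockDiagonal_conjTranspose,
      ← Matrix.blockDiagonal_mul, ← Matrix.blockDiagonal_mul]
    simp only [← Matrix.star_eq_conjTranspose, Unitary.coe_star_mul_self, Unitary.mul_star_self_of_mem (V _).2]
    exact ⟨Matrix.blockDiagonal_one, Matrix.blockDiagonal_one⟩⟩

theorem conj_blockUnitary_dup (V : o → unitary (Matrix κ κ ℂ)) (a : Matrix κ κ ℂ) :
    conj (blockUnitary V) (dup o a) = Matrix.blockDiagonal fun i => conj (V i) a := by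
  rw [conj_apply, blockUnitary, dup_apply, Matrix.star_eq_conjTranspose,
    Matrix.blockDiagonal_conjTranspose, ← Matrix.blockDiagonal_mul, ← Matrix.blockDiagonal_mul]
  rfl

/-- Each `V i` normalizes `A`, so the block unitary can be pulled out of the expectation, where it
does not affect the entropy. -/
theorem algEntropy_blockAlg [Nonempty o] {V : o → unitary (Matrix κ κ ℂ)} {A : Alg κ}
    (hA : ∀ i, A.map (conj (V i)) = A) {ρ : Matrix κ κ ℂ} (hρ : IsDensity ρ) :
    algEntropy (blockAlg o A) (conj (blockUnitary V) (dup o ((Fintype.card o : ℝ)⁻¹ • ρ))) =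
      algEntropy A ρ + Fintype.card o * Real.negMulLog (Fintype.card o : ℝ)⁻¹ / Real.log 2 := by
  have hsa := isSelfAdjoint_condExp A hρ.isSelfAdjoint
  have hsa' : IsSelfAdjoint ((Fintype.card o : ℝ)⁻¹ • condExp A ρ) := (IsSelfAdjoint.all _).smul hsa
  have hsmul : condExp A ((Fintype.card o : ℝ)⁻¹ • ρ) = (Fintype.card o : ℝ)⁻¹ • condExp A ρ := by
    rw [← Complex.coe_smul, condExp_smul, Complex.coe_smul]
  rw [algEntropy, conj_blockUnitary_dup, condExp_blockAlg]
  simp only [condExp_conj (hA _)]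
  rw [hsmul, ← conj_blockUnitary_dup,
    (isTraceIso_conj _).vonNeumannEntropy_map (hsa'.map (dup o)),
    vonNeumannEntropy_dup hsa (by rw [trace_condExp, hρ.2]), algEntropy]

theorem isDensity_dup [Nonempty o] {ρ : Matrix κ κ ℂ} (hρ : IsDensity ρ) :
    IsDensity (dup o ((Fintype.card o : ℝ)⁻¹ • ρ)) := by
  have hc : (Fintype.card o : ℂ) ≠ 0 := by exact_mod_cast Fintype.card_ne_zero
  have h1 : (dup o ρ).PosSemidef := by
    obtain ⟨b, hb⟩ := exists_eq_star_mul_self hρ.1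
    rw [hb, map_mul, map_star]
    exact Matrix.posSemidef_conjTranspose_mul_self _
  have h2 : dup o ((Fintype.card o : ℝ)⁻¹ • ρ) = (Fintype.card o : ℝ)⁻¹ • dup o ρ := by
    rw [← Complex.coe_smul, map_smul, Complex.coe_smul]
  refine ⟨h2 ▸ h1.smul (by positivity), ?_⟩
  rw [trace_dup, Matrix.trace_smul, hρ.2]
  simp [hc]

/-- The image of a unitary under a `*`-homomorphism. -/
abbrev mapUnitary (ι : Matrix n n ℂ →⋆ₐ[ℂ] Matrix κ κ ℂ) (U : unitary (Matrix n n ℂ)) :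
    unitary (Matrix κ κ ℂ) := ⟨ι U, Unitary.map_mem ι U.2⟩

theorem IsTensorPair.conj_mapUnitary {ι : Matrix n n ℂ →⋆ₐ[ℂ] Matrix κ κ ℂ} {N : Alg κ}
    (h : IsTensorPair ι N) (U : unitary (Matrix n n ℂ)) (a : Matrix n n ℂ) {b : Matrix κ κ ℂ}
    (hb : b ∈ N) : conj (mapUnitary ι U) (ι a * b) = ι (conj U a) * b := by
  rw [conj_apply, conj_apply, map_mul, map_mul, map_star, mul_assoc, mul_assoc, mul_assoc, mul_assoc,
    ← map_star, h.commute _ b hb]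

theorem IsTensorPair.map_amp_conj {ι : Matrix n n ℂ →⋆ₐ[ℂ] Matrix κ κ ℂ} {N : Alg κ}
    (h : IsTensorPair ι N) {U : unitary (Matrix n n ℂ)} {A : Alg n} (hA : A.map (conj U) = A) :
    (amp ι N A).map (conj (mapUnitary ι U)) = amp ι N A := by
  have key : ∀ U : unitary (Matrix n n ℂ), A.map (conj U) = A → ∀ x ∈ amp ι N A,
      conj (mapUnitary ι U) x ∈ amp ι N A := by
    intro U hU x hx
    refine h.amp_induction (p := fun x => conj (mapUnitary ι U) x ∈ amp ι N A) ?_ ?_ hx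
    · intro a ha b hb
      rw [h.conj_mapUnitary U a hb]
      refine mul_mem_amp ?_ hb
      rw [← hU]
      exact ⟨a, ha, rfl⟩
    · intro x y hx hy
      rw [map_add]
      exact add_mem hx hy
  refine map_conj_eq (key U hA) ?_
  have : star (mapUnitary ι U) = mapUnitary ι (star U) := Subtype.ext (map_star ι _).symm
  rw [this]
  exact key (star U) (map_conj_star_eq hA)

/-- Uniform averages over unitaries that normalize `S` and `T` do not increase the squashed mutual
information: an extension of `ρ` gives one of the average, with a register that records the
unitary in the additional factor. -/
theorem Isq_average_le [Nonempty n] [Nonempty o] {S T : Alg n} (hc : IsCommutingSquare S T)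
    (hi : S ⊓ T = ⊥) (hs : S ⊔ T = ⊤) (U : o → unitary (Matrix n n ℂ))
    (hS : ∀ i, S.map (conj (U i)) = S) (hT : ∀ i, T.map (conj (U i)) = T) (ρ : Matrix n n ℂ) :
    Isq S T (∑ i, (((Fintype.card o : ℝ)⁻¹ : ℝ) : ℂ) • conj (U i) ρ) ≤ Isq S T ρ := by
  refine Isq_le_Isq hi hs hc hi hs fun m ι N ρ' h => ⟨Fin m × o, inferInstance, inferInstance,
    (dup o).comp ι, blockAlg o N,
    conj (blockUnitary fun i => mapUnitary ι (U i)) (dup o ((Fintype.card o : ℝ)⁻¹ • ρ')),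
    ?_, ?_⟩
  · refine ⟨h.toIsTensorPair.dup, (isTraceIso_conj _).isDensity_map (isDensity_dup h.density),
      ?_, fun a => ?_⟩
    · rw [amp_dup, conj_blockUnitary_dup]
      refine blockDiagonal_mem_blockAlg fun i => ?_
      have h1 : (⊤ : Alg n).map (conj (U i)) = ⊤ :=
        StarSubalgebra.eq_top_iff.2 fun a => ⟨_, StarSubalgebra.mem_top, conj_conj_star (U i) a⟩
      rw [← h.map_amp_conj h1]
      refine ⟨_, ?_, rfl⟩
      rw [← Complex.coe_smul]
      exact (amp ι N ⊤).smul_mem h.mem _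
    · rw [conj_blockUnitary_dup, trace_blockDiagonal_mul, Finset.sum_mul, Matrix.trace_sum]
      refine Finset.sum_congr rfl fun i _ => ?_
      -- In each block the unitary is moved from the state to the observable.
      have h1 : conj (mapUnitary ι (U i)) (ι (conj (star (U i)) a)) = ι a := by
        simpa only [mul_one, conj_conj_star] using
          h.conj_mapUnitary (U i) (conj (star (U i)) a) (one_mem N)
      have h2 : (Fintype.card o : ℝ)⁻¹ • ρ' = (((Fintype.card o : ℝ)⁻¹ : ℝ) : ℂ) • ρ' :=
        (Complex.coe_smul _ _).symm
      rw [StarAlgHom.comp_apply, dup_apply, blk_blockDiagonal, if_pos rfl, ← h1, ← map_mul,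
        (isTraceIso_conj _).trace, h2, smul_mul_assoc, Matrix.trace_smul, h.expectation,
        smul_mul_assoc, Matrix.trace_smul, ← (isTraceIso_conj (U i)).trace, map_mul,
        conj_conj_star]
  · have hA : ∀ A : Alg n, (∀ i, A.map (conj (U i)) = A) → ∀ i,
        (amp ι N A).map (conj (mapUnitary ι (U i))) = amp ι N A :=
      fun A hA i => h.map_amp_conj (hA i)
    have hbot : ∀ i, (⊥ : Alg n).map (conj (U i)) = ⊥ := fun i => by
      rw [← hi, StarSubalgebra.map_inf _ (isTraceIso_conj _).injective, hS, hT]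
    have htop : ∀ i, (⊤ : Alg n).map (conj (U i)) = ⊤ := fun i => by
      rw [← hs, StarSubalgebra.map_sup, hS, hT]
    have h' := h.toIsTensorPair.dup (o := o)
    -- The four entropies are shifted by one and the same constant, which cancels in the mutual
    -- information.
    rw [mutualInfo, mutualInfo, h'.amp_inf hc, h.amp_inf hc, amp_sup, amp_sup, hi, hs]
    simp only [amp_dup]
    rw [algEntropy_blockAlg (hA S hS) h.density, algEntropy_blockAlg (hA T hT) h.density,
      algEntropy_blockAlg (hA ⊤ htop) h.density, algEntropy_blockAlg (hA ⊥ hbot) h.density]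
    linarith

end Block

/-! ### Pauli operators and the algebras they span -/

section Pauli

/-- The Pauli matrices `1, X, Y, Z`. -/
def pauli : Fin 4 → Matrix (Fin 2) (Fin 2) ℂ :=
  ![1, pauliX, !![0, -Complex.I; Complex.I, 0], pauliZ]

/-- Whether two Pauli matrices anticommute. -/
def anti (i j : Fin 4) : Bool := i ≠ 0 && j ≠ 0 && i ≠ j

theorem pauli_mul_mul (i j : Fin 4) :
    pauli i * pauli j * pauli i = (if anti i j then -1 else 1 : ℂ) • pauli j := by
  fin_cases i <;> fin_cases j <;>
    · ext a b
      fin_cases a <;> fin_cases b <;> simp [pauli, pauliX, pauliZ, anti, Matrix.one_fin_two]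

theorem pauli_mul_self (i : Fin 4) : pauli i * pauli i = 1 := by
  have := pauli_mul_mul i 0
  simpa [pauli, anti] using this

theorem conjTranspose_pauli (i : Fin 4) : (pauli i)ᴴ = pauli i := by
  fin_cases i <;>
    · ext a b
      fin_cases a <;> fin_cases b <;> simp [pauli, pauliX, pauliZ, Matrix.one_fin_two]

theorem trace_pauli_mul (i j : Fin 4) : (pauli i * pauli j).trace = if i = j then 2 else 0 := by
  fin_cases i <;> fin_cases j <;>
    simp [pauli, pauliX, pauliZ, Matrix.one_fin_two, Matrix.trace_fin_two] <;> norm_num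

/-- Completeness of the Pauli basis: `∑ P ⊗ P` is twice the swap. -/
theorem sum_pauli_mul_pauli (a b c d : Fin 2) :
    ∑ i, pauli i a b * pauli i c d = if a = d ∧ b = c then 2 else 0 := by
  fin_cases a <;> fin_cases b <;> fin_cases c <;> fin_cases d <;>
    simp [Fin.sum_univ_four, pauli, pauliX, pauliZ, Matrix.one_fin_two] <;> norm_num

theorem pauli_two_eq : pauli 2 = Complex.I • (pauli 1 * pauli 3) := by
  ext a b
  fin_cases a <;> fin_cases b <;> simp [pauli, pauliX, pauliZ]

/-- The labels of the two-qubit Pauli operators. -/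
abbrev Label : Type := Fin 4 × Fin 4

/-- The Pauli operators of two qubits. -/
def pauliOp (g : Label) : Matrix Qubits Qubits ℂ := pauli g.1 ⊗ₖ pauli g.2

/-- Whether two Pauli operators commute. -/
abbrev Comm (g h : Label) : Prop := anti g.1 h.1 = anti g.2 h.2

theorem pauliOp_mul (g h : Label) :
    pauliOp g * pauliOp h = (pauli g.1 * pauli h.1) ⊗ₖ (pauli g.2 * pauli h.2) :=
  (Matrix.mul_kronecker_mul _ _ _ _).symm

theorem pauliOp_mul_self (g : Label) : pauliOp g * pauliOp g = 1 := by
  rw [pauliOp_mul, pauli_mul_self, pauli_mul_self, Matrix.one_kronecker_one]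

theorem star_pauliOp (g : Label) : star (pauliOp g) = pauliOp g := by
  rw [Matrix.star_eq_conjTranspose, pauliOp, Matrix.conjTranspose_kronecker, conjTranspose_pauli,
    conjTranspose_pauli]

theorem pauliOp_mul_mul (g h : Label) :
    pauliOp g * pauliOp h * pauliOp g = (if Comm g h then 1 else -1 : ℂ) • pauliOp h := by
  rw [pauliOp_mul, pauliOp, ← Matrix.mul_kronecker_mul, pauli_mul_mul, pauli_mul_mul,
    Matrix.smul_kronecker, Matrix.kronecker_smul, smul_smul, pauliOp]
  congr 1
  unfold Comm
  generalize anti g.1 h.1 = x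
  generalize anti g.2 h.2 = y
  cases x <;> cases y <;> simp

theorem trace_pauliOp_mul (g h : Label) :
    (pauliOp g * pauliOp h).trace = if g = h then 4 else 0 := by
  rw [pauliOp_mul, Matrix.trace_kronecker, trace_pauli_mul, trace_pauli_mul]
  simp only [Prod.ext_iff]
  split_ifs <;> simp_all <;> norm_num

theorem pauliOp_commute {g h : Label} (hc : Comm g h) :
    pauliOp g * pauliOp h = pauliOp h * pauliOp g := by
  have := congrArg (· * pauliOp g) (pauliOp_mul_mul g h)
  simpa only [mul_assoc, pauliOp_mul_self, mul_one, if_pos hc, one_smul] using this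

theorem sum_trace_smul_pauliOp (a : Matrix Qubits Qubits ℂ) :
    ∑ g, (pauliOp g * a).trace • pauliOp g = (4 : ℂ) • a := by
  have key : ∀ x y u v : Qubits, ∑ g, pauliOp g x y * pauliOp g u v =
      if x = v ∧ y = u then 4 else 0 := by
    intro x y u v
    have : ∀ g : Label, pauliOp g x y * pauliOp g u v =
        (pauli g.1 x.1 y.1 * pauli g.1 u.1 v.1) * (pauli g.2 x.2 y.2 * pauli g.2 u.2 v.2) :=
      fun g => by simp only [pauliOp, Matrix.kroneckerMap_apply]; ring
    simp only [this, Fintype.sum_prod_type, ← Finset.mul_sum, sum_pauli_mul_pauli]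
    rw [← Finset.sum_mul, sum_pauli_mul_pauli]
    simp only [Prod.ext_iff]
    split_ifs <;> simp_all <;> norm_num
  ext u v
  have h1 : ∀ g, ((pauliOp g * a).trace • pauliOp g) u v =
      ∑ x, ∑ y, a y x * (pauliOp g x y * pauliOp g u v) := fun g => by
    simp only [Matrix.trace, Matrix.diag, Matrix.mul_apply, Matrix.smul_apply, smul_eq_mul,
      Finset.sum_mul]
    exact Finset.sum_congr rfl fun x _ => Finset.sum_congr rfl fun y _ => by ring
  rw [Matrix.sum_apply]
  simp only [h1]
  rw [Finset.sum_comm]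
  simp_rw [Finset.sum_comm (s := (Finset.univ : Finset Label)), ← Finset.mul_sum, key]
  simp [ite_and, mul_comm]

theorem eq_sum_pauliOp (a : Matrix Qubits Qubits ℂ) :
    a = ∑ g, ((1 / 4 : ℂ) * (pauliOp g * a).trace) • pauliOp g := by
  simp_rw [mul_smul]
  rw [← Finset.smul_sum, sum_trace_smul_pauliOp, smul_smul]
  norm_num

theorem pauliOp_ext {a b : Matrix Qubits Qubits ℂ}
    (h : ∀ g, (pauliOp g * a).trace = (pauliOp g * b).trace) : a = b := by
  rw [eq_sum_pauliOp a, eq_sum_pauliOp b]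
  simp only [h]

theorem trace_pauliOp_conj (g k : Label) (a : Matrix Qubits Qubits ℂ) :
    (pauliOp g * (pauliOp k * a * pauliOp k)).trace =
      (if Comm k g then 1 else -1) * (pauliOp g * a).trace := by
  rw [← smul_eq_mul (_ : ℂ), ← Matrix.trace_smul, ← smul_mul_assoc, ← pauliOp_mul_mul,
    ← mul_assoc, Matrix.trace_mul_comm]
  simp only [mul_assoc]

/-- Conjugation by the operator labelled `k` fixes `a` and reverses the sign of the one labelled
`g`. -/
theorem trace_pauliOp_eq_zero {g k : Label} {a : Matrix Qubits Qubits ℂ}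
    (ha : pauliOp k * a = a * pauliOp k) (hc : ¬ Comm k g) : (pauliOp g * a).trace = 0 := by
  have h := trace_pauliOp_conj g k a
  rw [ha, mul_assoc a, pauliOp_mul_self, mul_one, if_neg hc] at h
  linear_combination h / 2

/-- The subalgebra `A` is spanned by the Pauli operators with labels in `G`. -/
def IsPauliSpan (A : Alg Qubits) (G : Finset Label) : Prop :=
  ∀ a, a ∈ A ↔ ∀ g, g ∉ G → (pauliOp g * a).trace = 0

variable {A B : Alg Qubits} {G H K : Finset Label}

theorem mem_of_trace_eq_zero (hG : ∀ g ∈ G, pauliOp g ∈ A) {a : Matrix Qubits Qubits ℂ}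
    (ha : ∀ g, g ∉ G → (pauliOp g * a).trace = 0) : a ∈ A := by
  rw [eq_sum_pauliOp a]
  refine sum_mem fun g _ => ?_
  by_cases hg : g ∈ G
  · exact A.smul_mem (hG g hg) _
  · rw [ha g hg, mul_zero, zero_smul]
    exact zero_mem A

/-- The operators labelled by `K` commute with `A` and bound it from above; those labelled by `G`
bound it from below. What remains is a decidable condition on labels. -/
theorem isPauliSpan_of_commute (hA : ∀ a ∈ A, ∀ k ∈ K, pauliOp k * a = a * pauliOp k)
    (hG : ∀ g ∈ G, pauliOp g ∈ A) (hK : ∀ g, (∀ k ∈ K, Comm k g) → g ∈ G) : IsPauliSpan A G := by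
  refine fun a => ⟨fun ha g hg => ?_, mem_of_trace_eq_zero hG⟩
  have : ¬ ∀ k ∈ K, Comm k g := fun h => hg (hK g h)
  push Not at this
  obtain ⟨k, hk, hkg⟩ := this
  exact trace_pauliOp_eq_zero (hA a ha k hk) hkg

theorem isPauliSpan_adjoin {s : Set (Matrix Qubits Qubits ℂ)}
    (hs : ∀ a ∈ s, ∀ k ∈ K, pauliOp k * a = a * pauliOp k)
    (hG : ∀ g ∈ G, pauliOp g ∈ StarAlgebra.adjoin ℂ s) (hK : ∀ g, (∀ k ∈ K, Comm k g) → g ∈ G) :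
    IsPauliSpan (StarAlgebra.adjoin ℂ s) G := by
  refine isPauliSpan_of_commute (K := K) (fun a ha k hk => ?_) hG hK
  have hle : StarAlgebra.adjoin ℂ s ≤ StarSubalgebra.centralizer ℂ (pauliOp '' K) := by
    refine StarAlgebra.adjoin_le fun a ha => (StarSubalgebra.mem_centralizer_iff ℂ).2 ?_
    rintro _ ⟨k, hk, rfl⟩
    rw [star_pauliOp, and_self]
    exact hs a ha k hk
  exact ((StarSubalgebra.mem_centralizer_iff ℂ).1 (hle ha) _ ⟨k, hk, rfl⟩).1

theorem IsPauliSpan.pauliOp_mem (hA : IsPauliSpan A G) {g : Label} (hg : g ∈ G) : pauliOp g ∈ A :=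
  (hA _).2 fun h hh => by
    rw [trace_pauliOp_mul, if_neg]
    rintro rfl
    exact hh hg

theorem IsPauliSpan.le (hA : IsPauliSpan A G) (hB : ∀ g ∈ G, pauliOp g ∈ B) : A ≤ B :=
  fun a ha => mem_of_trace_eq_zero hB ((hA a).1 ha)

theorem IsPauliSpan.eq (hA : IsPauliSpan A G) (hB : IsPauliSpan B G) : A = B :=
  le_antisymm (hA.le fun _ => hB.pauliOp_mem) (hB.le fun _ => hA.pauliOp_mem)

theorem IsPauliSpan.inf (hA : IsPauliSpan A G) (hB : IsPauliSpan B H) :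
    IsPauliSpan (A ⊓ B) (G ∩ H) := fun a => by
  rw [StarSubalgebra.mem_inf, hA a, hB a]
  constructor
  · rintro ⟨h1, h2⟩ g hg
    rw [Finset.mem_inter, not_and_or] at hg
    exact hg.elim (h1 g) (h2 g)
  · exact fun h => ⟨fun g hg => h g fun h' => hg (Finset.mem_inter.1 h').1,
      fun g hg => h g fun h' => hg (Finset.mem_inter.1 h').2⟩

theorem IsPauliSpan.trace_condExp (hA : IsPauliSpan A G) (g : Label) (a : Matrix Qubits Qubits ℂ) :
    (pauliOp g * condExp A a).trace = if g ∈ G then (pauliOp g * a).trace else 0 := by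
  split_ifs with hg
  · rw [Matrix.trace_mul_comm, trace_condExp_mul A a (hA.pauliOp_mem hg), Matrix.trace_mul_comm]
  · exact (hA _).1 (condExp_mem A a) g hg

/-- In the Pauli basis both expectations are coordinate projections, and these commute. -/
theorem IsPauliSpan.isCommutingSquare (hA : IsPauliSpan A G) (hB : IsPauliSpan B H) :
    IsCommutingSquare A B := fun a => by
  constructor <;> refine pauliOp_ext fun g => ?_
  all_goals
    rw [(hA.inf hB).trace_condExp]
    simp only [hA.trace_condExp, hB.trace_condExp, Finset.mem_inter]
    by_cases h1 : g ∈ G <;> by_cases h2 : g ∈ H <;> simp [h1, h2]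

theorem IsPauliSpan.commutant (hA : IsPauliSpan A G) :
    IsPauliSpan (commutant A) (Finset.univ.filter fun h => ∀ g ∈ G, Comm g h) := by
  refine isPauliSpan_of_commute (K := G)
    (fun a ha k hk => mem_commutant_iff.1 ha _ (hA.pauliOp_mem hk)) (fun g hg => ?_)
    (fun g hg => by simpa using hg)
  have hg := (Finset.mem_filter.1 hg).2
  have hle : A ≤ StarSubalgebra.centralizer ℂ {pauliOp g} := hA.le fun h hh => by
    refine (StarSubalgebra.mem_centralizer_iff ℂ).2 ?_
    rintro _ rfl
    rw [star_pauliOp, and_self]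
    exact (pauliOp_commute (hg h hh)).symm
  exact mem_commutant_iff.2 fun a ha =>
    ((StarSubalgebra.mem_centralizer_iff ℂ).1 (hle ha) _ rfl).1.symm

theorem pauliOp_zero : pauliOp (0, 0) = 1 := Matrix.one_kronecker_one

theorem isPauliSpan_bot : IsPauliSpan ⊥ {(0, 0)} := by
  refine isPauliSpan_of_commute (K := Finset.univ) (fun _ ha k _ => ?_) (fun g hg => ?_) ?_
  · obtain ⟨c, rfl⟩ := mem_bot_iff_exists_smul.1 ha
    rw [smul_mul_assoc, mul_smul_comm, one_mul, mul_one]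
  · rw [Finset.mem_singleton.1 hg, pauliOp_zero]
    exact one_mem _
  · decide

theorem isPauliSpan_top : IsPauliSpan ⊤ Finset.univ := fun _ =>
  ⟨fun _ g hg => absurd (Finset.mem_univ g) hg, fun _ => StarSubalgebra.mem_top⟩

theorem IsPauliSpan.isBipartition (hA : IsPauliSpan A G) (hB : IsPauliSpan B H)
    (h : G ∩ H = {(0, 0)}) : IsBipartition A B where
  commuting := hA.isCommutingSquare hB
  cocommuting := hA.commutant.isCommutingSquare hB.commutant
  inf_eq_bot := (h ▸ hA.inf hB : IsPauliSpan (A ⊓ B) {(0, 0)}).eq isPauliSpan_bot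

/-- The Pauli operators as unitaries. -/
def pauliUnitary (g : Label) : unitary (Matrix Qubits Qubits ℂ) :=
  ⟨pauliOp g, by rw [Unitary.mem_iff, star_pauliOp, and_self, pauliOp_mul_self]⟩

theorem conj_pauliUnitary (g : Label) (a : Matrix Qubits Qubits ℂ) :
    conj (pauliUnitary g) a = pauliOp g * a * pauliOp g := by
  rw [conj_apply, pauliUnitary, star_pauliOp]

theorem star_pauliUnitary (g : Label) : star (pauliUnitary g) = pauliUnitary g :=
  Subtype.ext (star_pauliOp g)

theorem IsPauliSpan.map_conj (hA : IsPauliSpan A G) (k : Label) :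
    A.map (conj (pauliUnitary k)) = A := by
  have key : ∀ a ∈ A, conj (pauliUnitary k) a ∈ A := fun a ha => (hA _).2 fun g hg => by
    rw [conj_pauliUnitary, trace_pauliOp_conj, (hA a).1 ha g hg, mul_zero]
  exact map_conj_eq key (by rwa [star_pauliUnitary])

theorem pauliOp_mem_of_local {g : Label} (h1 : pauliOp (g.1, 0) ∈ A) (h2 : pauliOp (0, g.2) ∈ A) :
    pauliOp g ∈ A := by
  have : pauliOp g = pauliOp (g.1, 0) * pauliOp (0, g.2) := by
    rw [pauliOp_mul, pauliOp]
    change _ = (pauli g.1 * 1) ⊗ₖ (1 * pauli g.2)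
    rw [mul_one, one_mul]
  exact this ▸ mul_mem h1 h2

theorem pauliOp_two_left : pauliOp (2, 0) = Complex.I • (pauliOp (1, 0) * pauliOp (3, 0)) := by
  rw [pauliOp_mul, ← Matrix.smul_kronecker, ← pauli_two_eq, pauli_mul_self]
  rfl

theorem pauliOp_two_right : pauliOp (0, 2) = Complex.I • (pauliOp (0, 1) * pauliOp (0, 3)) := by
  rw [pauliOp_mul, ← Matrix.kronecker_smul, ← pauli_two_eq, pauli_mul_self]
  rfl

theorem pauliOp_left_mem (hX : pauliOp (1, 0) ∈ A) (hZ : pauliOp (3, 0) ∈ A) (i : Fin 4) :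
    pauliOp (i, 0) ∈ A := by
  fin_cases i
  · exact pauliOp_zero ▸ one_mem A
  · exact hX
  · change pauliOp (2, 0) ∈ A
    exact pauliOp_two_left ▸ A.smul_mem (mul_mem hX hZ) _
  · exact hZ

theorem pauliOp_right_mem (hX : pauliOp (0, 1) ∈ A) (hZ : pauliOp (0, 3) ∈ A) (i : Fin 4) :
    pauliOp (0, i) ∈ A := by
  fin_cases i
  · exact pauliOp_zero ▸ one_mem A
  · exact hX
  · change pauliOp (0, 2) ∈ A
    exact pauliOp_two_right ▸ A.smul_mem (mul_mem hX hZ) _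
  · exact hZ

theorem eq_top_of_pauliOp_mem (h1 : pauliOp (1, 0) ∈ A) (h2 : pauliOp (3, 0) ∈ A)
    (h3 : pauliOp (0, 1) ∈ A) (h4 : pauliOp (0, 3) ∈ A) : A = ⊤ :=
  top_le_iff.1 (isPauliSpan_top.le fun g _ =>
    pauliOp_mem_of_local (pauliOp_left_mem h1 h2 g.1) (pauliOp_right_mem h3 h4 g.2))

end Pauli

/-! ### The three pairs of algebras, the averaging, the state and the renaming -/

section TwoQubits

theorem onA_pauliX : onA pauliX = pauliOp (1, 0) := rfl
theorem onA_pauliZ : onA pauliZ = pauliOp (3, 0) := rfl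
theorem onB_pauliX : onB pauliX = pauliOp (0, 1) := rfl
theorem onB_pauliZ : onB pauliZ = pauliOp (0, 3) := rfl

theorem onA_mul_onB (a b : Matrix (Fin 2) (Fin 2) ℂ) : onA a * onB b = a ⊗ₖ b := by
  rw [onA, onB, ← Matrix.mul_kronecker_mul, mul_one, one_mul]

theorem onB_mul_onA (a b : Matrix (Fin 2) (Fin 2) ℂ) : onB b * onA a = a ⊗ₖ b := by
  rw [onA, onB, ← Matrix.mul_kronecker_mul, mul_one, one_mul]

theorem onA_pauliX_mul_onB_pauliX : onA pauliX * onB pauliX = pauliOp (1, 1) := onA_mul_onB _ _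
theorem onA_pauliZ_mul_onB_pauliZ : onA pauliZ * onB pauliZ = pauliOp (3, 3) := onA_mul_onB _ _

theorem isPauliSpan_ucrS : IsPauliSpan ucrS {(0, 0), (3, 0), (0, 3), (3, 3)} := by
  have h1 : pauliOp (3, 0) ∈ ucrS := StarAlgebra.subset_adjoin ℂ _ (Or.inl rfl)
  have h2 : pauliOp (0, 3) ∈ ucrS := StarAlgebra.subset_adjoin ℂ _ (Or.inr rfl)
  -- The algebra is maximal abelian, so commutation with its own generators characterizes it.
  refine isPauliSpan_adjoin (K := {(3, 0), (0, 3)}) ?_ ?_ (by decide)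
  · rintro _ (rfl | rfl) k hk
    · rw [onA_pauliZ]
      exact pauliOp_commute (by revert k; decide)
    · rw [onB_pauliZ]
      exact pauliOp_commute (by revert k; decide)
  · intro g hg
    simp only [Finset.mem_insert, Finset.mem_singleton] at hg
    rcases hg with rfl | rfl | rfl | rfl
    · exact pauliOp_zero ▸ one_mem ucrS
    · exact h1
    · exact h2
    · exact pauliOp_mem_of_local (A := ucrS) h1 h2

theorem isPauliSpan_ucrT : IsPauliSpan ucrT {(0, 0), (1, 0), (0, 1), (1, 1)} := by
  have h1 : pauliOp (1, 0) ∈ ucrT := StarAlgebra.subset_adjoin ℂ _ (Or.inl rfl)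
  have h2 : pauliOp (0, 1) ∈ ucrT := StarAlgebra.subset_adjoin ℂ _ (Or.inr rfl)
  refine isPauliSpan_adjoin (K := {(1, 0), (0, 1)}) ?_ ?_ (by decide)
  · rintro _ (rfl | rfl) k hk
    · rw [onA_pauliX]
      exact pauliOp_commute (by revert k; decide)
    · rw [onB_pauliX]
      exact pauliOp_commute (by revert k; decide)
  · intro g hg
    simp only [Finset.mem_insert, Finset.mem_singleton] at hg
    rcases hg with rfl | rfl | rfl | rfl
    · exact pauliOp_zero ▸ one_mem ucrT
    · exact h1
    · exact h2
    · exact pauliOp_mem_of_local (A := ucrT) h1 h2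

theorem isPauliSpan_eprS : IsPauliSpan eprS {(0, 0), (1, 0), (3, 3), (2, 3)} := by
  have h1 : pauliOp (1, 0) ∈ eprS := StarAlgebra.subset_adjoin ℂ _ (Or.inl rfl)
  have h2 : pauliOp (3, 3) ∈ eprS :=
    StarAlgebra.subset_adjoin ℂ _ (Or.inr onA_pauliZ_mul_onB_pauliZ.symm)
  have h3 : pauliOp (2, 3) = Complex.I • (pauliOp (1, 0) * pauliOp (3, 3)) := by
    rw [pauliOp_mul, ← Matrix.smul_kronecker, ← pauli_two_eq, pauliOp]
    exact congrArg _ (one_mul _).symm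
  -- These label the generators of `eprT`: the two algebras are each other's commutants.
  refine isPauliSpan_adjoin (K := {(1, 1), (0, 3)}) ?_ ?_ (by decide)
  · rintro _ (rfl | rfl) k hk
    · rw [onA_pauliX]
      exact pauliOp_commute (by revert k; decide)
    · rw [onA_pauliZ_mul_onB_pauliZ]
      exact pauliOp_commute (by revert k; decide)
  · intro g hg
    simp only [Finset.mem_insert, Finset.mem_singleton] at hg
    rcases hg with rfl | rfl | rfl | rfl
    · exact pauliOp_zero ▸ one_mem eprS
    · exact h1
    · exact h2
    · exact h3 ▸ eprS.smul_mem (mul_mem h1 h2) _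

theorem isPauliSpan_eprT : IsPauliSpan eprT {(0, 0), (1, 1), (0, 3), (1, 2)} := by
  have h1 : pauliOp (1, 1) ∈ eprT :=
    StarAlgebra.subset_adjoin ℂ _ (Or.inl onA_pauliX_mul_onB_pauliX.symm)
  have h2 : pauliOp (0, 3) ∈ eprT := StarAlgebra.subset_adjoin ℂ _ (Or.inr rfl)
  have h3 : pauliOp (1, 2) = Complex.I • (pauliOp (1, 1) * pauliOp (0, 3)) := by
    rw [pauliOp_mul, ← Matrix.kronecker_smul, ← pauli_two_eq, pauliOp]
    exact congrArg (fun a => Matrix.kroneckerMap (· * ·) a (pauli 2)) (mul_one (pauli 1)).symm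
  refine isPauliSpan_adjoin (K := {(1, 0), (3, 3)}) ?_ ?_ (by decide)
  · rintro _ (rfl | rfl) k hk
    · rw [onA_pauliX_mul_onB_pauliX]
      exact pauliOp_commute (by revert k; decide)
    · rw [onB_pauliZ]
      exact pauliOp_commute (by revert k; decide)
  · intro g hg
    simp only [Finset.mem_insert, Finset.mem_singleton] at hg
    rcases hg with rfl | rfl | rfl | rfl
    · exact pauliOp_zero ▸ one_mem eprT
    · exact h1
    · exact h2
    · exact h3 ▸ eprT.smul_mem (mul_mem h1 h2) _

theorem isPauliSpan_algA : IsPauliSpan algA {(0, 0), (1, 0), (2, 0), (3, 0)} := by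
  refine isPauliSpan_adjoin (K := {(0, 1), (0, 3)}) ?_ ?_ (by decide)
  · rintro _ ⟨a, rfl⟩ k hk
    simp only [Finset.mem_insert, Finset.mem_singleton] at hk
    rcases hk with rfl | rfl
    · exact (onB_mul_onA a pauliX).trans (onA_mul_onB a pauliX).symm
    · exact (onB_mul_onA a pauliZ).trans (onA_mul_onB a pauliZ).symm
  · intro g hg
    have : g.2 = 0 := by revert g; decide
    exact StarAlgebra.subset_adjoin ℂ _ ⟨pauli g.1, by rw [pauliOp, this]; rfl⟩

theorem isPauliSpan_algB : IsPauliSpan algB {(0, 0), (0, 1), (0, 2), (0, 3)} := by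
  refine isPauliSpan_adjoin (K := {(1, 0), (3, 0)}) ?_ ?_ (by decide)
  · rintro _ ⟨a, rfl⟩ k hk
    simp only [Finset.mem_insert, Finset.mem_singleton] at hk
    rcases hk with rfl | rfl
    · exact (onA_mul_onB pauliX a).trans (onB_mul_onA pauliX a).symm
    · exact (onA_mul_onB pauliZ a).trans (onB_mul_onA pauliZ a).symm
  · intro g hg
    have : g.1 = 0 := by revert g; decide
    exact StarAlgebra.subset_adjoin ℂ _ ⟨pauli g.2, by rw [pauliOp, this]; rfl⟩

theorem isBipartition_ucr : IsBipartition ucrS ucrT :=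
  isPauliSpan_ucrS.isBipartition isPauliSpan_ucrT (by decide)

theorem isBipartition_epr : IsBipartition eprS eprT :=
  isPauliSpan_eprS.isBipartition isPauliSpan_eprT (by decide)

theorem isBipartition_alg : IsBipartition algA algB :=
  isPauliSpan_algA.isBipartition isPauliSpan_algB (by decide)

theorem ucr_sup : ucrS ⊔ ucrT = ⊤ :=
  eq_top_of_pauliOp_mem
    (StarSubalgebra.mem_sup_right (isPauliSpan_ucrT.pauliOp_mem (by decide)))
    (StarSubalgebra.mem_sup_left (isPauliSpan_ucrS.pauliOp_mem (by decide)))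
    (StarSubalgebra.mem_sup_right (isPauliSpan_ucrT.pauliOp_mem (by decide)))
    (StarSubalgebra.mem_sup_left (isPauliSpan_ucrS.pauliOp_mem (by decide)))

theorem epr_sup : eprS ⊔ eprT = ⊤ := by
  have hXA : pauliOp (1, 0) ∈ eprS ⊔ eprT :=
    StarSubalgebra.mem_sup_left (isPauliSpan_eprS.pauliOp_mem (by decide))
  have hZZ : pauliOp (3, 3) ∈ eprS ⊔ eprT :=
    StarSubalgebra.mem_sup_left (isPauliSpan_eprS.pauliOp_mem (by decide))
  have hXX : pauliOp (1, 1) ∈ eprS ⊔ eprT :=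
    StarSubalgebra.mem_sup_right (isPauliSpan_eprT.pauliOp_mem (by decide))
  have hZB : pauliOp (0, 3) ∈ eprS ⊔ eprT :=
    StarSubalgebra.mem_sup_right (isPauliSpan_eprT.pauliOp_mem (by decide))
  refine eq_top_of_pauliOp_mem hXA ?_ ?_ hZB
  · have : pauliOp (3, 0) = pauliOp (3, 3) * pauliOp (0, 3) := by
      rw [pauliOp_mul, pauli_mul_self]
      exact congrArg (fun a => Matrix.kroneckerMap (· * ·) a 1) (mul_one (pauli 3)).symm
    exact this ▸ mul_mem hZZ hZB
  · have : pauliOp (0, 1) = pauliOp (1, 0) * pauliOp (1, 1) := by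
      rw [pauliOp_mul, pauli_mul_self]
      exact congrArg _ (one_mul (pauli 1)).symm
    exact this ▸ mul_mem hXA hXX

/-- The fixed points of the conjugation by `Y_A Y_B`. -/
def parityAlg : Alg Qubits := StarSubalgebra.centralizer ℂ {pauliOp (2, 2)}

theorem isPauliSpan_parityAlg :
    IsPauliSpan parityAlg (Finset.univ.filter fun g => Comm (2, 2) g) := by
  refine isPauliSpan_of_commute (K := {(2, 2)}) ?_ ?_ (by decide)
  · intro a ha k hk
    rw [Finset.mem_singleton.1 hk]
    exact ((StarSubalgebra.mem_centralizer_iff ℂ).1 ha _ rfl).1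
  · intro g hg
    refine (StarSubalgebra.mem_centralizer_iff ℂ).2 ?_
    rintro _ rfl
    rw [star_pauliOp, and_self]
    exact pauliOp_commute (Finset.mem_filter.1 hg).2

/-- The unitaries `1` and `Y_A Y_B`. -/
def parityUnitary : Fin 2 → unitary (Matrix Qubits Qubits ℂ) :=
  ![pauliUnitary (0, 0), pauliUnitary (2, 2)]

/-- Conjugation by `Y_A Y_B` fixes the Pauli operators that commute with it and negates the others,
so the average is the projection onto the former. -/
theorem condExp_parityAlg (a : Matrix Qubits Qubits ℂ) :
    condExp parityAlg a = ∑ i, ((1 / 2 : ℝ) : ℂ) • conj (parityUnitary i) a := by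
  refine pauliOp_ext fun g => ?_
  have h1 : conj (parityUnitary 0) a = a := by
    rw [show parityUnitary 0 = pauliUnitary (0, 0) from rfl, conj_pauliUnitary, pauliOp_zero,
      one_mul, mul_one]
  have h2 : conj (parityUnitary 1) a = pauliOp (2, 2) * a * pauliOp (2, 2) :=
    conj_pauliUnitary (2, 2) a
  rw [isPauliSpan_parityAlg.trace_condExp, Fin.sum_univ_two, h1, h2, mul_add, Matrix.trace_add,
    mul_smul_comm, mul_smul_comm, Matrix.trace_smul, Matrix.trace_smul, trace_pauliOp_conj]
  simp only [Finset.mem_filter, Finset.mem_univ, true_and]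
  split_ifs <;> simp <;> ring

theorem IsPauliSpan.map_parityUnitary {A : Alg Qubits} {G : Finset Label} (hA : IsPauliSpan A G)
    (i : Fin 2) : A.map (conj (parityUnitary i)) = A := by
  fin_cases i
  · exact hA.map_conj (0, 0)
  · exact hA.map_conj (2, 2)

theorem isCovariantReplacement_parityAlg {S T S' T' : Alg Qubits} {G H G' H' : Finset Label}
    (hS : IsPauliSpan S G) (hT : IsPauliSpan T H) (hS' : IsPauliSpan S' G')
    (hT' : IsPauliSpan T' H') (hs : S ⊔ T = ⊤) (hs' : S' ⊔ T' = ⊤)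
    (hl : (G' ∩ Finset.univ.filter fun g => Comm (2, 2) g) =
      G ∩ Finset.univ.filter fun g => Comm (2, 2) g)
    (hr : (H' ∩ Finset.univ.filter fun g => Comm (2, 2) g) =
      H ∩ Finset.univ.filter fun g => Comm (2, 2) g)
    (hi : (G' ∩ H') = G ∩ H) :
    IsCovariantReplacement S T S' T' parityAlg (fun _ => 1 / 2) parityUnitary where
  square := hS.isCommutingSquare hT
  square' := hS'.isCommutingSquare hT'
  weight_nonneg _ := by norm_num
  weight_sum := by norm_num
  average := condExp_parityAlg
  covariant_left i a := condExp_conj (hS.map_parityUnitary i) a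
  covariant_right i a := condExp_conj (hT.map_parityUnitary i) a
  covariant_sup i a := by
    rw [hs]
    exact condExp_conj (isPauliSpan_top.map_parityUnitary i) a
  covariant_inf i a := condExp_conj ((hS.inf hT).map_parityUnitary i) a
  sup_eq := hs'.trans hs.symm
  left_inf := (hl ▸ hS'.inf isPauliSpan_parityAlg :
    IsPauliSpan (S' ⊓ parityAlg) _).eq (hS.inf isPauliSpan_parityAlg)
  right_inf := (hr ▸ hT'.inf isPauliSpan_parityAlg :
    IsPauliSpan (T' ⊓ parityAlg) _).eq (hT.inf isPauliSpan_parityAlg)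
  inf_inf := by
    rw [(hi ▸ hS'.inf hT' : IsPauliSpan (S' ⊓ T') _).eq (hS.inf hT)]

theorem invSqrtTwo_mul_self : invSqrtTwo * invSqrtTwo = 1 / 2 := by
  rw [invSqrtTwo, ← Complex.ofReal_mul]
  have : (1 / Real.sqrt 2) * (1 / Real.sqrt 2) = 1 / 2 := by
    rw [div_mul_div_comm, one_mul, Real.mul_self_sqrt (by norm_num)]
  rw [this]
  norm_num

theorem ucrKet_apply (p : Qubits) :
    ucrKet p = 1 / 2 * (![1, Complex.I] p.1 * ![1, Complex.I] p.2) := by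
  rw [← invSqrtTwo_mul_self]
  obtain ⟨a, b⟩ := p
  fin_cases a <;> fin_cases b <;> simp [ucrKet, prodKet, ketUpY, ket0, ket1] <;> ring_nf
  rw [Complex.I_sq]
  ring

theorem eprKet_apply (p : Qubits) :
    eprKet p = 1 / 2 * ![![1, -1], ![Complex.I, Complex.I]] p.1 p.2 := by
  rw [← invSqrtTwo_mul_self]
  obtain ⟨a, b⟩ := p
  fin_cases a <;> fin_cases b <;> simp [eprKet, prodKet, ketPlus, ketMinus, ket0, ket1] <;> ring

theorem star_ucrKet_dotProduct : star ucrKet ⬝ᵥ ucrKet = 1 := by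
  simp only [dotProduct, Pi.star_apply, ucrKet_apply, Fintype.sum_prod_type, Fin.sum_univ_two]
  simp
  ring_nf
  rw [Complex.I_sq]
  norm_num

theorem pauliOp_mulVec_ucrKet {k : Label} (hk : k = (2, 0) ∨ k = (0, 2)) :
    pauliOp k *ᵥ ucrKet = ucrKet := by
  ext ⟨a, b⟩
  rcases hk with rfl | rfl <;> fin_cases a <;> fin_cases b <;>
    simp [Matrix.mulVec, dotProduct, ucrKet_apply, Fintype.sum_prod_type, pauliOp, pauli,
      Matrix.one_apply] <;> ring_nf <;> simp only [Complex.I_sq] <;> ring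

theorem pauliOp_mul_ketbra {k : Label} (hk : k = (2, 0) ∨ k = (0, 2)) :
    pauliOp k * ketbra ucrKet = ketbra ucrKet := by
  rw [ketbra, Matrix.mul_vecMulVec, pauliOp_mulVec_ucrKet hk]

theorem ketbra_mul_pauliOp {k : Label} (hk : k = (2, 0) ∨ k = (0, 2)) :
    ketbra ucrKet * pauliOp k = ketbra ucrKet := by
  have h := congrArg star (pauliOp_mul_ketbra hk)
  rwa [star_mul, star_pauliOp, (isStarProjection_ketbra star_ucrKet_dotProduct).isSelfAdjoint.star_eq]
    at h

/-- The state is stabilized by `Y_A` and `Y_B`, labelled `(2, 0)` and `(0, 2)`. -/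
theorem trace_pauliOp_mul_ketbra {g : Label} (h : ¬ Comm (2, 0) g ∨ ¬ Comm (0, 2) g) :
    (pauliOp g * ketbra ucrKet).trace = 0 := by
  rcases h with h | h
  · exact trace_pauliOp_eq_zero
      ((pauliOp_mul_ketbra (.inl rfl)).trans (ketbra_mul_pauliOp (.inl rfl)).symm) h
  · exact trace_pauliOp_eq_zero
      ((pauliOp_mul_ketbra (.inr rfl)).trans (ketbra_mul_pauliOp (.inr rfl)).symm) h

/-- Only labels with both entries in `{0, 2}` can contribute, so only these have to agree in `G` and
`H`. -/
theorem IsPauliSpan.condExp_ketbra {A B : Alg Qubits} {G H : Finset Label} (hA : IsPauliSpan A G)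
    (hB : IsPauliSpan B H)
    (h : ∀ g, (¬ Comm (2, 0) g ∨ ¬ Comm (0, 2) g) ∨ (g ∈ G ↔ g ∈ H)) :
    condExp A (ketbra ucrKet) = condExp B (ketbra ucrKet) := by
  refine pauliOp_ext fun g => ?_
  rw [hA.trace_condExp, hB.trace_condExp]
  rcases h g with h | h
  · rw [trace_pauliOp_mul_ketbra h]
    simp
  · simp only [h]

theorem condExp_parityAlg_ketbra : condExp parityAlg (ketbra ucrKet) = ketbra ucrKet :=
  (isPauliSpan_parityAlg.condExp_ketbra isPauliSpan_top (by decide)).trans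
    (condExp_of_mem StarSubalgebra.mem_top)

/-- The controlled negation `|a, b⟩ ↦ |a + b, b⟩`. -/
def cnot : Matrix Qubits Qubits ℂ := Matrix.of fun p q => if p = (q.1 + q.2, q.2) then 1 else 0

theorem cnot_apply (p q : Qubits) : cnot p q = if p = (q.1 + q.2, q.2) then 1 else 0 := rfl

theorem star_cnot : star cnot = cnot := by
  ext ⟨a, b⟩ ⟨c, d⟩
  rw [Matrix.star_apply, cnot_apply, cnot_apply]
  have : ((c, d) = ((a + b, b) : Qubits)) ↔ ((a, b) = ((c + d, d) : Qubits)) := by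
    revert a b c d; decide
  simp only [this]
  split_ifs <;> simp

theorem cnot_mul_apply (a : Matrix Qubits Qubits ℂ) (p q : Qubits) :
    (cnot * a) p q = a (p.1 + p.2, p.2) q := by
  have : ∀ r : Qubits, p = (r.1 + r.2, r.2) ↔ (p.1 + p.2, p.2) = r := by
    revert p; decide
  simp [Matrix.mul_apply, cnot_apply, this]

theorem mul_cnot_apply (a : Matrix Qubits Qubits ℂ) (p q : Qubits) :
    (a * cnot) p q = a p (q.1 + q.2, q.2) := by
  simp [Matrix.mul_apply, cnot_apply]

theorem cnot_mul_self : cnot * cnot = 1 := by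
  ext p q
  rw [cnot_mul_apply, cnot_apply, Matrix.one_apply]
  have : (((p.1 + p.2, p.2) : Qubits) = (q.1 + q.2, q.2)) ↔ p = q := by
    revert p q; decide
  simp only [this]

/-- The controlled negation as a unitary. -/
def cnotUnitary : unitary (Matrix Qubits Qubits ℂ) :=
  ⟨cnot, by rw [Unitary.mem_iff, star_cnot, and_self, cnot_mul_self]⟩

theorem conj_cnot_apply (a : Matrix Qubits Qubits ℂ) (p q : Qubits) :
    conj cnotUnitary a p q = a (p.1 + p.2, p.2) (q.1 + q.2, q.2) := by
  rw [conj_apply, cnotUnitary, star_cnot, mul_cnot_apply, cnot_mul_apply]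

/-- With control `B` and target `A`, the generators of `eprS` become `X_A, Z_A`, and those of `eprT`
become `X_B, Z_B`. -/
theorem conj_cnot_pauliOp {g h : Label}
    (hgh : (g = (1, 0) ∧ h = (1, 0)) ∨ (g = (3, 3) ∧ h = (3, 0)) ∨ (g = (1, 1) ∧ h = (0, 1)) ∨
      (g = (0, 3) ∧ h = (0, 3))) : conj cnotUnitary (pauliOp g) = pauliOp h := by
  ext ⟨a, b⟩ ⟨c, d⟩
  rw [conj_cnot_apply]
  rcases hgh with ⟨rfl, rfl⟩ | ⟨rfl, rfl⟩ | ⟨rfl, rfl⟩ | ⟨rfl, rfl⟩ <;>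
    fin_cases a <;> fin_cases b <;> fin_cases c <;> fin_cases d <;>
    simp [pauliOp, pauli, pauliX, pauliZ, Matrix.one_fin_two]

theorem map_cnot_eprS : eprS.map (conj cnotUnitary) = algA := by
  rw [eprS, StarAlgHom.map_adjoin, Set.image_pair, onA_pauliZ_mul_onB_pauliZ, onA_pauliX,
    conj_cnot_pauliOp (h := (1, 0)) (by simp), conj_cnot_pauliOp (h := (3, 0)) (by simp)]
  refine le_antisymm (StarAlgebra.adjoin_le ?_) (isPauliSpan_algA.le fun g hg => ?_)
  · rintro _ (rfl | rfl)
    · exact isPauliSpan_algA.pauliOp_mem (by decide)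
    · exact isPauliSpan_algA.pauliOp_mem (by decide)
  · obtain ⟨i, rfl⟩ : ∃ i, g = (i, 0) := by revert g; decide
    exact pauliOp_left_mem (StarAlgebra.subset_adjoin ℂ _ (Or.inl rfl))
      (StarAlgebra.subset_adjoin ℂ _ (Or.inr rfl)) i

theorem map_cnot_eprT : eprT.map (conj cnotUnitary) = algB := by
  rw [eprT, StarAlgHom.map_adjoin, Set.image_pair, onA_pauliX_mul_onB_pauliX, onB_pauliZ,
    conj_cnot_pauliOp (h := (0, 1)) (by simp), conj_cnot_pauliOp (h := (0, 3)) (by simp)]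
  refine le_antisymm (StarAlgebra.adjoin_le ?_) (isPauliSpan_algB.le fun g hg => ?_)
  · rintro _ (rfl | rfl)
    · exact isPauliSpan_algB.pauliOp_mem (by decide)
    · exact isPauliSpan_algB.pauliOp_mem (by decide)
  · obtain ⟨i, rfl⟩ : ∃ i, g = (0, i) := by revert g; decide
    exact pauliOp_right_mem (StarAlgebra.subset_adjoin ℂ _ (Or.inl rfl))
      (StarAlgebra.subset_adjoin ℂ _ (Or.inr rfl)) i

theorem cnot_mulVec_ucrKet : cnot *ᵥ ucrKet = eprKet := by
  ext ⟨a, b⟩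
  rw [eprKet_apply]
  simp only [Matrix.mulVec, dotProduct, Fintype.sum_prod_type, Fin.sum_univ_two, ucrKet_apply,
    cnot_apply]
  fin_cases a <;> fin_cases b <;> simp

theorem conj_ketbra {n : Type} [Fintype n] [DecidableEq n] (U : unitary (Matrix n n ℂ))
    (v : n → ℂ) : conj U (ketbra v) = ketbra ((U : Matrix n n ℂ) *ᵥ v) := by
  rw [conj_apply, ketbra, ketbra, Matrix.mul_vecMulVec, Matrix.vecMulVec_mul, Matrix.star_mulVec,
    Matrix.star_eq_conjTranspose]

theorem isMaximallyEntangled_eprKet : IsMaximallyEntangled eprKet := by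
  constructor <;> intro a b <;> fin_cases a <;> fin_cases b <;>
    simp [ketbra, Matrix.vecMulVec_apply, eprKet_apply] <;> ring_nf <;>
    simp only [Complex.I_sq] <;> ring

theorem Isq_condExp_parityAlg_le {S T : Alg Qubits} {G H : Finset Label} (hS : IsPauliSpan S G)
    (hT : IsPauliSpan T H) (hi : S ⊓ T = ⊥) (hs : S ⊔ T = ⊤) (ρ : Matrix Qubits Qubits ℂ) :
    Isq S T (condExp parityAlg ρ) ≤ Isq S T ρ := by
  have := Isq_average_le (hS.isCommutingSquare hT) hi hs parityUnitary hS.map_parityUnitary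
    hT.map_parityUnitary ρ
  rw [condExp_parityAlg]
  simpa using this

theorem Iconv_condExp_parityAlg_le {S T : Alg Qubits} {G H : Finset Label} (hS : IsPauliSpan S G)
    (hT : IsPauliSpan T H) (ρ : Matrix Qubits Qubits ℂ) :
    Iconv S T (condExp parityAlg ρ) ≤ Iconv S T ρ := by
  rw [condExp_parityAlg]
  exact Iconv_average_le (fun _ => 1 / 2) (fun _ => by norm_num) (by norm_num) parityUnitary
    hS.map_parityUnitary hT.map_parityUnitary ρ

end TwoQubits
end SubalgebraResource
end

open SubalgebraResource
theorem corollary5 :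
    (IsBipartition ucrS ucrT ∧ IsBipartition eprS eprT ∧ IsBipartition algA algB) ∧
    (∃ (R : Alg Qubits) (k : ℕ) (w : Fin k → ℝ) (U : Fin k → unitary (Matrix Qubits Qubits ℂ)),
      IsCovariantReplacement ucrS ucrT eprS eprT R w U ∧
      IsCovariantReplacement eprS eprT ucrS ucrT R w U ∧
      condExp R (ketbra ucrKet) = ketbra ucrKet ∧
      (∀ ρ, IsDensity ρ →
        Isq ucrS ucrT (condExp R ρ) ≤ Isq ucrS ucrT ρ ∧
        Iconv ucrS ucrT (condExp R ρ) ≤ Iconv ucrS ucrT ρ ∧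
        Isq eprS eprT (condExp R ρ) ≤ Isq eprS eprT ρ ∧
        Iconv eprS eprT (condExp R ρ) ≤ Iconv eprS eprT ρ) ∧
      (Isq eprS eprT (condExp R (ketbra ucrKet)) ≤ Isq ucrS ucrT (ketbra ucrKet) ∧
        Iconv eprS eprT (condExp R (ketbra ucrKet)) ≤ Iconv ucrS ucrT (ketbra ucrKet)) ∧
      (Isq ucrS ucrT (condExp R (ketbra ucrKet)) ≤ Isq eprS eprT (ketbra ucrKet) ∧
        Iconv ucrS ucrT (condExp R (ketbra ucrKet)) ≤ Iconv eprS eprT (ketbra ucrKet))) ∧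
    (∃ V : unitary (Matrix Qubits Qubits ℂ),
      eprS.map (conj V) = algA ∧ eprT.map (conj V) = algB ∧
      (V : Matrix Qubits Qubits ℂ).mulVec ucrKet = eprKet ∧
      conj V (ketbra ucrKet) = ketbra eprKet ∧
      ∀ ρ, IsDensity ρ →
        Isq algA algB (conj V ρ) = Isq eprS eprT ρ ∧
        Iconv algA algB (conj V ρ) = Iconv eprS eprT ρ) ∧
    IsMaximallyEntangled eprKet := by
  have hu := isBipartition_ucr
  have he := isBipartition_epr
  have hv := star_ucrKet_dotProduct
  -- The identity is the only Pauli operator in either algebra that commutes with both `Y_A` and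
  -- `Y_B`, so both sides are maximally mixed.
  have hS : condExp eprS (ketbra ucrKet) = condExp ucrS (ketbra ucrKet) :=
    isPauliSpan_eprS.condExp_ketbra isPauliSpan_ucrS (by decide)
  have hT : condExp eprT (ketbra ucrKet) = condExp ucrT (ketbra ucrKet) :=
    isPauliSpan_eprT.condExp_ketbra isPauliSpan_ucrT (by decide)
  have hI : mutualInfo eprS eprT (ketbra ucrKet) = mutualInfo ucrS ucrT (ketbra ucrKet) :=
    mutualInfo_eq_of_condExp_eq hu.inf_eq_bot ucr_sup he.inf_eq_bot epr_sup hS hT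
  refine ⟨⟨hu, he, isBipartition_alg⟩, ⟨parityAlg, 2, fun _ => 1 / 2, parityUnitary,
    isCovariantReplacement_parityAlg isPauliSpan_ucrS isPauliSpan_ucrT isPauliSpan_eprS
      isPauliSpan_eprT ucr_sup epr_sup (by decide) (by decide) (by decide),
    isCovariantReplacement_parityAlg isPauliSpan_eprS isPauliSpan_eprT isPauliSpan_ucrS
      isPauliSpan_ucrT epr_sup ucr_sup (by decide) (by decide) (by decide),
    condExp_parityAlg_ketbra, fun ρ _ =>
      ⟨Isq_condExp_parityAlg_le isPauliSpan_ucrS isPauliSpan_ucrT hu.inf_eq_bot ucr_sup ρ,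
        Iconv_condExp_parityAlg_le isPauliSpan_ucrS isPauliSpan_ucrT ρ,
        Isq_condExp_parityAlg_le isPauliSpan_eprS isPauliSpan_eprT he.inf_eq_bot epr_sup ρ,
        Iconv_condExp_parityAlg_le isPauliSpan_eprS isPauliSpan_eprT ρ⟩, ?_, ?_⟩,
    ⟨cnotUnitary, map_cnot_eprS, map_cnot_eprT, cnot_mulVec_ucrKet, ?_, fun ρ _ =>
      ⟨Isq_conj he.commuting he.inf_eq_bot epr_sup map_cnot_eprS map_cnot_eprT ρ,
        Iconv_conj map_cnot_eprS map_cnot_eprT ρ⟩⟩, isMaximallyEntangled_eprKet⟩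
  · rw [condExp_parityAlg_ketbra]
    exact ⟨Isq_le_Isq_of_pure hv hu.commuting hu.inf_eq_bot ucr_sup he.commuting he.inf_eq_bot
      epr_sup hS hT, Iconv_le_Iconv_of_pure hv hI⟩
  · rw [condExp_parityAlg_ketbra]
    exact ⟨Isq_le_Isq_of_pure hv he.commuting he.inf_eq_bot epr_sup hu.commuting hu.inf_eq_bot
      ucr_sup hS.symm hT.symm, Iconv_le_Iconv_of_pure hv hI.symm⟩
  · rw [conj_ketbra]
    exact congrArg ketbra cnot_mulVec_ucrKet
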